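/- **Setting.** Let $\mathrm{IP}$ be a type of addresses and $\mathrm{Data}$ a non-empty type of application layer data. AODV is the specification of the Ad hoc On-Demand Distance Vector routing protocol in the process algebra AWN (Algebra of Wireless Networks). A network consists of finitely many nodes with distinct addresses. A node $ip$ has a transmission range $R^{ip}\subseteq\mathrm{IP}$ and runs the main process AODV in parallel with a message queue QMSG; AODV, with the subroutines NEWPKT, PKT, RREQ, RREP and RERR, handles injected data packets, data packets, route requests, route replies and route errors, sends queued data packets for destinations with a valid route, and issues route requests. Initially, each node has own sequence number $1$, an empty routing table, an empty set of seen route request identifiers, no stored data packets and an empty message queue; the ranges are arbitrary. The transitions are those given by the structural operational semantics of AWN (including connecting and disconnecting nodes, and injecting new packets). **Complete runs.** A path of a sequential process is complete if it is infinite, or no internal or output transition is enabled in its last state (sending to the parallel process on the same node and receiving are neither internal nor output; broadcast, groupcast, unicast, its failure, and delivery are outputs). A path of a parallel process, a node, a partial network or a network is complete if it has the same property and, moreover, it derives from complete paths of its components (justness). A *run* of AODV is a complete path that starts in an initial state and satisfies the following fairness properties, for all $ip,dip\in\mathrm{IP}$: - (F$_1$) $\mathbf G\big(\mathbf G(ip\text{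 has queued data packets for and a valid route to }dip)\Rightarrow\mathbf F(ip\text{ tries to unicast a data packet from }ip\text{ to }dip)\big)$; - (F$_2$) $\mathbf G\big(\mathbf G(ip\text{ has queued data packets for }dip\text{, no valid route to }dip\text{, and its request-required flag for }dip\text{ is set})\Rightarrow\mathbf F(ip\text{ broadcasts a route request that it originates for }dip)\big)$; - (F$_3$) $\mathbf G\big(\mathbf G(\text{the message queue of }ip\text{ is non-empty})\Rightarrow\mathbf F(\text{the process QMSG on }ip\text{ performs a send action})\big)$. LTL formulas are interpreted on (finite or infinite) paths with an additional position halfway each transition; at that position the predicates on transitions are evaluated for this transition, and the predicates on states for its target state. **Route discovery.** AODV satisfies *route discovery* if, for all $oip,dip\in\mathrm{IP}$, every run of AODV satisfies $$\mathbf G\Big(\big(\mathbf{connected}^*(oip,dip)\wedge\mathbf{broadcast}(\mathrm{rreq}(*,*,dip,*,*,oip,*,oip))\big)\Rightarrow\mathbf F\big(dip\in\mathrm{vD}^{oip}\vee\mathbf{disconnect}(*,*)\big)\Big).$$ Here $\mathbf{connected}^*(oip,dip)$ says that there are nodes $ip_0=oip,\,ip_1,\dots,ip_n=dip$ with $ip_i\in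 R^{ip_{i-1}}$ for $1\le i\le n$; $\mathbf{broadcast}(\mathrm{rreq}(*,*,dip,*,*,oip,*,oip))$ says that the node $oip$ issues a request for a route from $oip$ to $dip$; $dip\in\mathrm{vD}^{oip}$ says that $oip$ has a valid route to $dip$ in its routing table; and $\mathbf{disconnect}(*,*)$ says that some link is broken. **Theorem.** AODV does not satisfy route discovery. More precisely, for any three distinct addresses $s,a,d$ there is a run of AODV (a complete path satisfying (F$_1$)–(F$_3$)) that starts in the initial state with exactly the nodes $s,a,d$ in the linear topology $s - a - d$ (that is, $R^s=\{a\}$, $R^a=\{s,d\}$, $R^d=\{a\}$), such that 1. no connect or disconnect transition occurs in the run; 2. at some point of the run, the intermediate node $a$ silently drops a route reply with originator $s$ and destination $d$, because it would not change the routing table of $a$; 3. the run violates the route discovery formula for $oip=s$ and $dip=d$: at some point $s$, while connected to $d$, broadcasts a request for a route to $d$, but at that point and ever after $s$ has no valid route to $d$. -/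

import Mathlib

/-!
AODV (Ad hoc On-Demand Distance Vector routing) specified in the process algebra AWN
(Algebra of Wireless Networks), with the progress/justness notion of a complete path,
the fairness component, linear-time temporal logic, and the route discovery property.

`IP` is the type of node identifiers and `Data` the type of application layer data.
-/

namespace AODV

/-! ### Data structure -/

/-- Sequence-number-status flag: known or unknown. -/
inductive SqnKnown
  | kno
  | unk

/-- Validity of a route. -/
inductive Flag
  | val
  | inv

/-- Request-required flag: a route request still has to be issued (`req`) or not (`noreq`). -/
inductive ReqFlag
  | req
  | noreq

/-- A routing table entry, without its destination. Sequence numbers are natural numbers, `0` being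
the unknown sequence number. -/
structure Entry (IP : Type) where
  dsn : ℕ
  dsk : SqnKnown
  flag : Flag
  hops : ℕ
  nhip : IP
  pre : Set IP

/-- Routing tables: sets of routes with at most one entry per destination,
i.e. partial functions from destinations to entries. -/
abbrev RT (IP : Type) := IP → Option (Entry IP)

/-- Sets of unreachable destinations with sequence numbers (partial functions). -/
abbrev Dests (IP : Type) := IP → Option ℕ

/-- Stores of queued data packets: for each destination at most one queue, with a flag. -/
abbrev Store (IP Data : Type) := IP → Option (ReqFlag × List Data)

/-- Messages. -/
inductive Msg (IP Data : Type)
  | rreq (hops rreqid : ℕ) (dip : IP) (dsn : ℕ) (dsk : SqnKnown) (oip : IP) (osn : ℕ) (sip : IP)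
  | rrep (hops : ℕ) (dip : IP) (dsn : ℕ) (oip sip : IP)
  | rerr (dests : Dests IP) (sip : IP)
  | newpkt (data : Data) (dip : IP)
  | pkt (data : Data) (dip oip : IP)

section DataFunctions

variable {IP Data : Type}

/-- Increment a sequence number, leaving the unknown number `0` unchanged. -/
def inc (n : ℕ) : ℕ := if n = 0 then 0 else n + 1

def sqn (rt : RT IP) (dip : IP) : ℕ := (rt dip).elim 0 Entry.dsn

def sqnf (rt : RT IP) (dip : IP) : SqnKnown := (rt dip).elim .unk Entry.dsk

def dhops (rt : RT IP) (dip : IP) : Option ℕ := (rt dip).map Entry.hops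

def nhop (rt : RT IP) (dip : IP) : Option IP := (rt dip).map Entry.nhip

def precs (rt : RT IP) (dip : IP) : Option (Set IP) := (rt dip).map Entry.pre

/-- Destinations with a valid route. -/
def vD (rt : RT IP) : Set IP := {dip | ∃ e, rt dip = some e ∧ e.flag = .val}

/-- Destinations with an invalid route. -/
def iD (rt : RT IP) : Set IP := {dip | ∃ e, rt dip = some e ∧ e.flag = .inv}

def Entry.addpre (e : Entry IP) (npre : Set IP) : Entry IP := { e with pre := e.pre ∪ npre }

open Classical in
/-- Add precursors to the entry for `dip`; defined only if there is such an entry. -/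
noncomputable def addpreRT (rt : RT IP) (dip : IP) (npre : Set IP) : Option (RT IP) :=
  (rt dip).map fun e => Function.update rt dip (some (e.addpre npre))

open Classical in
/-- Update a routing table with a route `r` to `dip` (a partial function). -/
noncomputable def update (rt : RT IP) (dip : IP) (r : Entry IP) : Option (RT IP) :=
  if r.flag = .val ∧ (r.dsn = 0 ↔ r.dsk = .unk) ∧ (r.dsk = .unk → r.hops = 1) then
    some (Function.update rt dip (some (match rt dip with
      | none => r
      | some s =>
        if s.dsn < r.dsn ∨ (s.dsn = r.dsn ∧ r.hops < s.hops) ∨ (s.dsn = r.dsn ∧ s.flag = .inv) then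
          r.addpre s.pre
        else if r.dsk = .unk then
          { r.addpre s.pre with dsn := s.dsn }
        else
          s.addpre r.pre)))
  else none

/-- Invalidate the routes to the given destinations, with the given new sequence numbers. -/
def invalidate (rt : RT IP) (dests : Dests IP) : RT IP := fun rip =>
  (rt rip).map fun e => (dests rip).elim e fun rsn => { e with dsn := rsn, flag := .inv }

open Classical in
/-- A fresh route request identifier: `max {n | (ip, n) ∈ rreqs} + 1`, where the maximum of the
empty set is `0` (and that of an unbounded set is undefined). -/
noncomputable def nrreqid (rreqs : Set (IP × ℕ)) (ip : IP) : Option ℕ :=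
  if BddAbove {n | (ip, n) ∈ rreqs} then some (sSup {n | (ip, n) ∈ rreqs} + 1) else none

/-- Destinations with queued data packets. -/
def qD (store : Store IP Data) : Set IP := {dip | ∃ x, store dip = some x}

/-- The queue of data packets for a destination. -/
def selQueue (store : Store IP Data) (dip : IP) : List Data := (store dip).elim [] Prod.snd

/-- The request-required flag for a destination; undefined if there is no queue for it. -/
def selFlag (store : Store IP Data) (dip : IP) : Option ReqFlag := (store dip).map Prod.fst

open Classical in
/-- Append a data packet to the queue for `dip`. -/
noncomputable def add (data : Data) (dip : IP) (store : Store IP Data) : Store IP Data :=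
  Function.update store dip (some (match store dip with
    | none => (.req, [data])
    | some (p, q) => (p, q ++ [data])))

open Classical in
/-- Drop the oldest packet for `dip`, and the whole entry if no packet is left. -/
noncomputable def drop (dip : IP) (store : Store IP Data) : Option (Store IP Data) :=
  match store dip with
  | some (_, [_]) => some (Function.update store dip none)
  | some (p, _ :: x :: q) => some (Function.update store dip (some (p, x :: q)))
  | _ => none

open Classical in
/-- Set the flag for `dip` to `noreq`. -/
noncomputable def unsetRRF (store : Store IP Data) (dip : IP) : Store IP Data :=
  Function.update store dip ((store dip).map fun x => (.noreq, x.2))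

/-- Set the flag for all the given destinations to `req`. -/
def setRRF (store : Store IP Data) (dests : Dests IP) : Store IP Data := fun dip =>
  (store dip).map fun x => (dests dip).elim x fun _ => (.req, x.2)

open Classical in
/-- The valid destinations that have the same next hop as `dip`, with incremented sequence numbers. -/
noncomputable def brokenDests (rt : RT IP) (dip : IP) : Dests IP := fun rip =>
  if rip ∈ vD rt ∧ ∃ n, nhop rt rip = some n ∧ nhop rt dip = some n then some (inc (sqn rt rip))
  else none

open Classical in
/-- The destinations of an error message, sent by `sip`, that affect the routing table. -/
noncomputable def affectedDests (rt : RT IP) (dests : Dests IP) (sip : IP) : Dests IP := fun rip =>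
  if rip ∈ vD rt ∧ nhop rt rip = some sip ∧ ∃ rsn, dests rip = some rsn ∧ sqn rt rip < rsn then
    dests rip
  else none

/-- The union of the precursor lists of the given destinations. -/
def allPrecs (rt : RT IP) (dests : Dests IP) : Set IP :=
  {x | ∃ rip n P, dests rip = some n ∧ precs rt rip = some P ∧ x ∈ P}

open Classical in
/-- The given destinations that have a non-empty precursor list. -/
noncomputable def withPrecs (rt : RT IP) (dests : Dests IP) : Dests IP := fun rip =>
  if ∃ P, precs rt rip = some P ∧ P ≠ ∅ then dests rip else none

open Classical in
/-- The partial function with a single pair. -/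
noncomputable def singleDest (rip : IP) (rsn : ℕ) : Dests IP := fun x =>
  if x = rip then some rsn else none

end DataFunctions

/-! ### Sequential processes -/

/-- The data variables. -/
inductive Var
  | ip | sn | rt | rreqs | store
  | msg | data | dip | oip | sip | hops | rreqid | dsn | dsk | osn | dests | pre | msgs
  deriving DecidableEq

/-- The types of the data variables. -/
abbrev Var.ty (IP Data : Type) : Var → Type
  | .ip | .dip | .oip | .sip => IP
  | .sn | .hops | .rreqid | .dsn | .osn => ℕ
  | .rt => RT IP
  | .rreqs => Set (IP × ℕ)
  | .store => Store IP Data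
  | .msg => Msg IP Data
  | .data => Data
  | .dsk => SqnKnown
  | .dests => Dests IP
  | .pre => Set IP
  | .msgs => List (Msg IP Data)

/-- Valuations: partial assignments of data values to the data variables. -/
abbrev Val (IP Data : Type) := (v : Var) → Option (v.ty IP Data)

/-- Data expressions, as partial functions of a valuation. -/
abbrev Exp (IP Data α : Type) := Val IP Data → Option α

/-- Process names. -/
inductive PName
  | aodv | newpkt | pkt | rreq | rrep | rerr | qmsg

/-- Sequential process expressions. A call lists its arguments by the parameter they instantiate
(arguments for variables that are not parameters of the called process are ignored). A guard is
given with the set of its free variables. -/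
inductive SP (IP Data : Type)
  | call (X : PName) (args : (v : Var) → Exp IP Data (v.ty IP Data))
  | guard (fv : Set Var) (φ : Val IP Data → Prop) (p : SP IP Data)
  | assign (v : Var) (e : Exp IP Data (v.ty IP Data)) (p : SP IP Data)
  | choice (p q : SP IP Data)
  | bcast (ms : Exp IP Data (Msg IP Data)) (p : SP IP Data)
  | gcast (dests : Exp IP Data (Set IP)) (ms : Exp IP Data (Msg IP Data)) (p : SP IP Data)
  | ucast (dest : Exp IP Data IP) (ms : Exp IP Data (Msg IP Data)) (p q : SP IP Data)
  | send (ms : Exp IP Data (Msg IP Data)) (p : SP IP Data)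
  | deliver (data : Exp IP Data Data) (p : SP IP Data)
  | receive (p : SP IP Data)

/-- Actions of sequential and parallel processes. -/
inductive Act (IP Data : Type)
  | bcast (m : Msg IP Data)
  | gcast (D : Set IP) (m : Msg IP Data)
  | ucast (dip : IP) (m : Msg IP Data)
  | notUcast (dip : IP) (m : Msg IP Data)
  | send (m : Msg IP Data)
  | deliver (d : Data)
  | receive (m : Msg IP Data)
  | tau

variable {IP Data : Type}

/-- `Extends fv φ ξ ζ`: `ζ` extends `ξ` by values of exactly the variables in `fv` that were still
undefined, in such a way that `φ` holds. -/
def Extends (fv : Set Var) (φ : Val IP Data → Prop) (ξ ζ : Val IP Data) : Prop :=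
  (∀ v, ξ v ≠ none → ζ v = ξ v) ∧ (∀ v, ξ v = none → v ∉ fv → ζ v = none) ∧
    (∀ v ∈ fv, ζ v ≠ none) ∧ φ ζ

/-- The formal parameters of the processes. -/
def params : PName → Set Var
  | .aodv => {.ip, .sn, .rt, .rreqs, .store}
  | .newpkt => {.data, .dip, .ip, .sn, .rt, .rreqs, .store}
  | .pkt => {.data, .dip, .oip, .ip, .sn, .rt, .rreqs, .store}
  | .rreq => {.hops, .rreqid, .dip, .dsn, .dsk, .oip, .osn, .sip, .ip, .sn, .rt, .rreqs, .store}
  | .rrep => {.hops, .dip, .dsn, .oip, .sip, .ip, .sn, .rt, .rreqs, .store}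
  | .rerr => {.dests, .sip, .ip, .sn, .rt, .rreqs, .store}
  | .qmsg => {.msgs}

/-- A call in which each parameter is instantiated by the variable of the same name. -/
def SP.callVars (X : PName) : SP IP Data := .call X fun v ξ => ξ v

/-- A call of the message queue process with the given argument. -/
def SP.callQmsg (e : Exp IP Data (List (Msg IP Data))) : SP IP Data :=
  .call .qmsg fun v => match v with
    | .msgs => e
    | v => fun ξ => ξ v

/-- Invalidate the routes in `dests` and report this to their precursors. -/
noncomputable def invalidateAndReport : SP IP Data :=
  .assign .rt (fun ξ => do return invalidate (← ξ .rt) (← ξ .dests)) <|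
  .assign .store (fun ξ => do return setRRF (← ξ .store) (← ξ .dests)) <|
  .assign .pre (fun ξ => do return allPrecs (← ξ .rt) (← ξ .dests)) <|
  .assign .dests (fun ξ => do return withPrecs (← ξ .rt) (← ξ .dests)) <|
  .gcast (fun ξ => ξ .pre) (fun ξ => do return .rerr (← ξ .dests) (← ξ .ip)) <|
  .callVars .aodv

/-- The reaction to a failed unicast to the next hop on the route to `dest`. -/
noncomputable def onFailure (dest : Exp IP Data IP) : SP IP Data :=
  .assign .dests (fun ξ => do return brokenDests (← ξ .rt) (← dest ξ)) invalidateAndReport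

/-- The next hop on the route to `dest`. -/
def nhopTo (dest : Exp IP Data IP) : Exp IP Data IP := fun ξ => do nhop (← ξ .rt) (← dest ξ)

/-- `rt := update(rt, (sip, 0, unk, val, 1, sip, ∅))`, followed by `p`. -/
noncomputable def updateSip (p : SP IP Data) : SP IP Data :=
  .assign .rt (fun ξ => do
    let sip ← ξ .sip
    update (← ξ .rt) sip ⟨0, .unk, .val, 1, sip, ∅⟩) p

/-- The basic routine. -/
noncomputable def aodvBody : SP IP Data :=
  .choice
    (.receive
      (.choice (.guard {.msg, .data, .dip}
          (fun ξ => ∃ data dip, ξ .data = some data ∧ ξ .dip = some dip ∧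
            ξ .msg = some (.newpkt data dip))
        (.callVars .newpkt)) <|
      .choice (.guard {.msg, .data, .dip, .oip}
          (fun ξ => ∃ data dip oip, ξ .data = some data ∧ ξ .dip = some dip ∧ ξ .oip = some oip ∧
            ξ .msg = some (.pkt data dip oip))
        (.callVars .pkt)) <|
      .choice (.guard {.msg, .hops, .rreqid, .dip, .dsn, .dsk, .oip, .osn, .sip}
          (fun ξ => ∃ hops rreqid dip dsn dsk oip osn sip, ξ .hops = some hops ∧
            ξ .rreqid = some rreqid ∧ ξ .dip = some dip ∧ ξ .dsn = some dsn ∧ ξ .dsk = some dsk ∧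
            ξ .oip = some oip ∧ ξ .osn = some osn ∧ ξ .sip = some sip ∧
            ξ .msg = some (.rreq hops rreqid dip dsn dsk oip osn sip))
        (updateSip (.callVars .rreq))) <|
      .choice (.guard {.msg, .hops, .dip, .dsn, .oip, .sip}
          (fun ξ => ∃ hops dip dsn oip sip, ξ .hops = some hops ∧ ξ .dip = some dip ∧
            ξ .dsn = some dsn ∧ ξ .oip = some oip ∧ ξ .sip = some sip ∧
            ξ .msg = some (.rrep hops dip dsn oip sip))
        (updateSip (.callVars .rrep)))
      (.guard {.msg, .dests, .sip}
          (fun ξ => ∃ dests sip, ξ .dests = some dests ∧ ξ .sip = some sip ∧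
            ξ .msg = some (.rerr dests sip))
        (updateSip (.callVars .rerr))))) <|
  .choice
    -- send a queued data packet for which a valid route is known
    (.guard {.dip, .store, .rt}
        (fun ξ => ∃ dip store rt, ξ .dip = some dip ∧ ξ .store = some store ∧ ξ .rt = some rt ∧
          dip ∈ qD store ∩ vD rt) <|
      .assign .data (fun ξ => do (selQueue (← ξ .store) (← ξ .dip)).head?) <|
      .ucast (nhopTo fun ξ => ξ .dip) (fun ξ => do return .pkt (← ξ .data) (← ξ .dip) (← ξ .ip))
        (.assign .store (fun ξ => do drop (← ξ .dip) (← ξ .store)) <|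
          .callVars .aodv)
        (onFailure fun ξ => ξ .dip))
    -- initiate a route discovery process
    (.guard {.dip, .store, .rt}
        (fun ξ => ∃ dip store rt, ξ .dip = some dip ∧ ξ .store = some store ∧ ξ .rt = some rt ∧
          dip ∈ qD store \ vD rt ∧ selFlag store dip = some .req) <|
      .assign .store (fun ξ => do return unsetRRF (← ξ .store) (← ξ .dip)) <|
      .assign .sn (fun ξ => do return inc (← ξ .sn)) <|
      .assign .rreqid (fun ξ => do nrreqid (← ξ .rreqs) (← ξ .ip)) <|
      .assign .rreqs (fun ξ => do return (← ξ .rreqs) ∪ {(← ξ .ip, ← ξ .rreqid)}) <|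
      .bcast (fun ξ => do
          let rt ← ξ .rt
          let dip ← ξ .dip
          let ip ← ξ .ip
          return .rreq 0 (← ξ .rreqid) dip (sqn rt dip) (sqnf rt dip) ip (← ξ .sn) ip) <|
      .callVars .aodv)

/-- Handling of a newly injected data packet. -/
noncomputable def newpktBody : SP IP Data :=
  .choice
    (.guard {.dip, .ip} (fun ξ => ∃ dip ip, ξ .dip = some dip ∧ ξ .ip = some ip ∧ dip = ip) <|
      .deliver (fun ξ => ξ .data) <|
      .callVars .aodv)
    (.guard {.dip, .ip} (fun ξ => ∃ dip ip, ξ .dip = some dip ∧ ξ .ip = some ip ∧ dip ≠ ip) <|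
      .assign .store (fun ξ => do return add (← ξ .data) (← ξ .dip) (← ξ .store)) <|
      .callVars .aodv)

/-- Handling of a received data packet. -/
noncomputable def pktBody : SP IP Data :=
  .choice
    (.guard {.dip, .ip} (fun ξ => ∃ dip ip, ξ .dip = some dip ∧ ξ .ip = some ip ∧ dip = ip) <|
      .deliver (fun ξ => ξ .data) <|
      .callVars .aodv)
    (.guard {.dip, .ip} (fun ξ => ∃ dip ip, ξ .dip = some dip ∧ ξ .ip = some ip ∧ dip ≠ ip) <|
      .choice
        (.guard {.dip, .rt} (fun ξ => ∃ dip rt, ξ .dip = some dip ∧ ξ .rt = some rt ∧ dip ∈ vD rt) <|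
          .ucast (nhopTo fun ξ => ξ .dip) (fun ξ => do return .pkt (← ξ .data) (← ξ .dip) (← ξ .oip))
            (.callVars .aodv)
            (onFailure fun ξ => ξ .dip))
        (.guard {.dip, .rt} (fun ξ => ∃ dip rt, ξ .dip = some dip ∧ ξ .rt = some rt ∧ dip ∉ vD rt) <|
          .choice
            (.guard {.dip, .rt}
                (fun ξ => ∃ dip rt, ξ .dip = some dip ∧ ξ .rt = some rt ∧ dip ∈ iD rt) <|
              .gcast (fun ξ => do precs (← ξ .rt) (← ξ .dip))
                (fun ξ => do
                  let rt ← ξ .rt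
                  let dip ← ξ .dip
                  return .rerr (singleDest dip (sqn rt dip)) (← ξ .ip)) <|
              .callVars .aodv)
            (.guard {.dip, .rt}
                (fun ξ => ∃ dip rt, ξ .dip = some dip ∧ ξ .rt = some rt ∧ dip ∉ iD rt) <|
              .callVars .aodv)))

/-- Handling of a route request. -/
noncomputable def rreqBody : SP IP Data :=
  .choice
    (.guard {.oip, .rreqid, .rreqs}
        (fun ξ => ∃ oip rreqid rreqs, ξ .oip = some oip ∧ ξ .rreqid = some rreqid ∧
          ξ .rreqs = some rreqs ∧ (oip, rreqid) ∈ rreqs) <|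
      .callVars .aodv)
    (.guard {.oip, .rreqid, .rreqs}
        (fun ξ => ∃ oip rreqid rreqs, ξ .oip = some oip ∧ ξ .rreqid = some rreqid ∧
          ξ .rreqs = some rreqs ∧ (oip, rreqid) ∉ rreqs) <|
      .assign .rt (fun ξ => do
        update (← ξ .rt) (← ξ .oip) ⟨← ξ .osn, .kno, .val, (← ξ .hops) + 1, ← ξ .sip, ∅⟩) <|
      .assign .rreqs (fun ξ => do return (← ξ .rreqs) ∪ {(← ξ .oip, ← ξ .rreqid)}) <|
      .choice
        -- the node is the destination: issue a route reply
        (.guard {.dip, .ip} (fun ξ => ∃ dip ip, ξ .dip = some dip ∧ ξ .ip = some ip ∧ dip = ip) <|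
          .assign .sn (fun ξ => do return max (← ξ .sn) (← ξ .dsn)) <|
          .ucast (nhopTo fun ξ => ξ .oip)
            (fun ξ => do return .rrep 0 (← ξ .dip) (← ξ .sn) (← ξ .oip) (← ξ .ip))
            (.callVars .aodv)
            (onFailure fun ξ => ξ .oip))
        (.guard {.dip, .ip} (fun ξ => ∃ dip ip, ξ .dip = some dip ∧ ξ .ip = some ip ∧ dip ≠ ip) <|
          .choice
            -- a fresh enough route is known: issue an intermediate route reply
            (.guard {.dip, .rt, .dsn}
                (fun ξ => ∃ dip rt dsn, ξ .dip = some dip ∧ ξ .rt = some rt ∧ ξ .dsn = some dsn ∧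
                  dip ∈ vD rt ∧ dsn ≤ sqn rt dip ∧ sqnf rt dip = .kno) <|
              .assign .rt (fun ξ => do addpreRT (← ξ .rt) (← ξ .dip) {← ξ .sip}) <|
              .assign .rt (fun ξ => do
                let rt ← ξ .rt
                addpreRT rt (← ξ .oip) {← nhop rt (← ξ .dip)}) <|
              .ucast (nhopTo fun ξ => ξ .oip)
                (fun ξ => do
                  let rt ← ξ .rt
                  let dip ← ξ .dip
                  return .rrep (← dhops rt dip) dip (sqn rt dip) (← ξ .oip) (← ξ .ip))
                (.callVars .aodv)
                (onFailure fun ξ => ξ .oip))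
            -- forward the route request
            (.guard {.dip, .rt, .dsn}
                (fun ξ => ∃ dip rt dsn, ξ .dip = some dip ∧ ξ .rt = some rt ∧ ξ .dsn = some dsn ∧
                  (dip ∉ vD rt ∨ sqn rt dip < dsn ∨ sqnf rt dip = .unk)) <|
              .bcast (fun ξ => do
                  let rt ← ξ .rt
                  let dip ← ξ .dip
                  return .rreq ((← ξ .hops) + 1) (← ξ .rreqid) dip (max (sqn rt dip) (← ξ .dsn))
                    (← ξ .dsk) (← ξ .oip) (← ξ .osn) (← ξ .ip)) <|
              .callVars .aodv)))

/-- `update(rt, (dip, dsn, kno, val, hops + 1, sip, ∅))`, used when handling a route reply. -/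
noncomputable def rrepUpdate : Exp IP Data (RT IP) := fun ξ => do
  update (← ξ .rt) (← ξ .dip) ⟨← ξ .dsn, .kno, .val, (← ξ .hops) + 1, ← ξ .sip, ∅⟩

/-- Handling of a route reply. -/
noncomputable def rrepBody : SP IP Data :=
  .choice
    (.guard {.rt, .dip, .dsn, .hops, .sip}
        (fun ξ => ∃ rt rt', ξ .rt = some rt ∧ rrepUpdate ξ = some rt' ∧ rt ≠ rt') <|
      .assign .rt rrepUpdate <|
      .choice
        (.guard {.oip, .ip} (fun ξ => ∃ oip ip, ξ .oip = some oip ∧ ξ .ip = some ip ∧ oip = ip) <|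
          .callVars .aodv)
        (.guard {.oip, .ip} (fun ξ => ∃ oip ip, ξ .oip = some oip ∧ ξ .ip = some ip ∧ oip ≠ ip) <|
          .choice
            (.guard {.oip, .rt}
                (fun ξ => ∃ oip rt, ξ .oip = some oip ∧ ξ .rt = some rt ∧ oip ∈ vD rt) <|
              .assign .rt (fun ξ => do
                let rt ← ξ .rt
                addpreRT rt (← ξ .dip) {← nhop rt (← ξ .oip)}) <|
              .assign .rt (fun ξ => do
                let rt ← ξ .rt
                addpreRT rt (← nhop rt (← ξ .dip)) {← nhop rt (← ξ .oip)}) <|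
              .ucast (nhopTo fun ξ => ξ .oip)
                (fun ξ => do
                  return .rrep ((← ξ .hops) + 1) (← ξ .dip) (← ξ .dsn) (← ξ .oip) (← ξ .ip))
                (.callVars .aodv)
                (onFailure fun ξ => ξ .oip))
            (.guard {.oip, .rt}
                (fun ξ => ∃ oip rt, ξ .oip = some oip ∧ ξ .rt = some rt ∧ oip ∉ vD rt) <|
              .callVars .aodv)))
    -- the reply carries no new information and is silently ignored
    (.guard {.rt, .dip, .dsn, .hops, .sip}
        (fun ξ => ∃ rt, ξ .rt = some rt ∧ rrepUpdate ξ = some rt) <|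
      .callVars .aodv)

/-- Handling of a route error message. -/
noncomputable def rerrBody : SP IP Data :=
  .assign .dests (fun ξ => do return affectedDests (← ξ .rt) (← ξ .dests) (← ξ .sip))
    invalidateAndReport

/-- `receive(msg).QMSG(append(msg, msgs))` -/
def qmsgReceive : SP IP Data :=
  .receive (.callQmsg fun ξ => do return (← ξ .msgs) ++ [← ξ .msg])

/-- The message queue. -/
def qmsgBody : SP IP Data :=
  .choice qmsgReceive
    (.guard {.msgs} (fun ξ => ∃ msgs, ξ .msgs = some msgs ∧ msgs ≠ []) <|
      .choice
        (.send (fun ξ => do (← ξ .msgs).head?) <|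
          .callQmsg fun ξ => do
            match ← ξ .msgs with
            | [] => none
            | _ :: t => some t)
        qmsgReceive)

/-- The defining equations of the processes. -/
noncomputable def body : PName → SP IP Data
  | .aodv => aodvBody
  | .newpkt => newpktBody
  | .pkt => pktBody
  | .rreq => rreqBody
  | .rrep => rrepBody
  | .rerr => rerrBody
  | .qmsg => qmsgBody

open Classical in
/-- The valuation that only assigns to the parameters of `X`, namely the values of the arguments. -/
noncomputable def bindArgs (X : PName) (args : (v : Var) → Exp IP Data (v.ty IP Data))
    (ξ : Val IP Data) : Val IP Data :=
  fun v => if v ∈ params X then args v ξ else none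

/-- Structural operational semantics of sequential processes with valuations. -/
inductive SeqStep : Val IP Data × SP IP Data → Act IP Data → Val IP Data × SP IP Data → Prop
  | bcast {ξ ms p m} : ms ξ = some m → SeqStep (ξ, .bcast ms p) (.bcast m) (ξ, p)
  | gcast {ξ dests ms p D m} : dests ξ = some D → ms ξ = some m →
      SeqStep (ξ, .gcast dests ms p) (.gcast D m) (ξ, p)
  | ucast {ξ dest ms p q dip m} : dest ξ = some dip → ms ξ = some m →
      SeqStep (ξ, .ucast dest ms p q) (.ucast dip m) (ξ, p)
  | notUcast {ξ dest ms p q dip m} : dest ξ = some dip → ms ξ = some m →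
      SeqStep (ξ, .ucast dest ms p q) (.notUcast dip m) (ξ, q)
  | send {ξ ms p m} : ms ξ = some m → SeqStep (ξ, .send ms p) (.send m) (ξ, p)
  | deliver {ξ data p d} : data ξ = some d → SeqStep (ξ, .deliver data p) (.deliver d) (ξ, p)
  | receive {ξ p} (m : Msg IP Data) :
      SeqStep (ξ, .receive p) (.receive m) (Function.update ξ .msg (some m), p)
  | assign {ξ v e p x} : e ξ = some x →
      SeqStep (ξ, .assign v e p) .tau (Function.update ξ v (some x), p)
  | call {ξ X args a s} : (∀ v ∈ params X, args v ξ ≠ none) →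
      SeqStep (bindArgs X args ξ, body X) a s → SeqStep (ξ, .call X args) a s
  | choiceLeft {ξ p q a s} : SeqStep (ξ, p) a s → SeqStep (ξ, .choice p q) a s
  | choiceRight {ξ p q a s} : SeqStep (ξ, q) a s → SeqStep (ξ, .choice p q) a s
  | guard {ξ ζ fv φ p} : Extends fv φ ξ ζ → SeqStep (ξ, .guard fv φ p) .tau (ζ, p)

/-! ### Parallel processes, nodes and networks

Every transition above the level of sequential processes is decorated with the list of the actions
of sequential processes that occur in its derivation (on the level of nodes and networks together
with the address of the node). The decoration does not influence which transitions exist.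

The rules for the parallel compositions relate the (optional) transitions of the components to the
transition of the composition; `none` means that the component does not take part. -/

/-- Perform a transition, or stay idle. -/
def Moves {σ α : Type} (T : σ → α → σ → Prop) (s : σ) : Option α → σ → Prop
  | none, s' => s' = s
  | some a, s' => T s a s'

/-- Parallel process expressions. -/
inductive PP (IP Data : Type)
  | seq (s : Val IP Data × SP IP Data)
  | par (P Q : PP IP Data)

/-- Decorated transition labels of parallel processes. -/
abbrev PLabel (IP Data : Type) := Act IP Data × List (Act IP Data)

/-- The rules for the parallel composition of processes on the same node. -/
inductive ParRule : Option (PLabel IP Data) → Option (PLabel IP Data) → PLabel IP Data → Prop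
  | left {a t} : (∀ m, a ≠ .receive m) → ParRule (some (a, t)) none (a, t)
  | right {a t} : (∀ m, a ≠ .send m) → ParRule none (some (a, t)) (a, t)
  | sync {m t u} : ParRule (some (.receive m, t)) (some (.send m, u)) (.tau, t ++ u)

/-- Transitions of parallel processes. -/
def ParStep : PP IP Data → PLabel IP Data → PP IP Data → Prop
  | .seq s, l, P' => ∃ s', P' = .seq s' ∧ l.2 = [l.1] ∧ SeqStep s l.1 s'
  | .par P Q, l, P' => ∃ P₁ Q₁ o₁ o₂, P' = .par P₁ Q₁ ∧ ParRule o₁ o₂ l ∧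
      Moves (fun _ => ParStep P) P o₁ P₁ ∧ Moves (fun _ => ParStep Q) Q o₂ Q₁

/-- Partial network expressions. -/
inductive PNet (IP Data : Type)
  | node (ip : IP) (P : PP IP Data) (R : Set IP)
  | par (M N : PNet IP Data)

/-- Transition labels of (partial) networks. -/
inductive NAct (IP Data : Type)
  | cast (R : Set IP) (m : Msg IP Data)
  | arrive (H K : Set IP) (m : Msg IP Data)
  | connect (ip ip' : IP)
  | disconnect (ip ip' : IP)
  | newpkt (ip : IP) (d : Data) (dip : IP)
  | deliver (ip : IP) (d : Data)
  | tau

/-- Decorated transition labels of (partial) networks. -/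
abbrev NLabel (IP Data : Type) := NAct IP Data × List (IP × Act IP Data)

/-- The rules for node expressions: `NodeRule ip R o l R'` says that a node `ip` with range `R` has
a transition labelled `l`, after which it has range `R'`, stemming from a transition `o` of the
process on that node (or leaving that process as it is, if `o = none`). -/
inductive NodeRule (ip : IP) :
    Set IP → Option (PLabel IP Data) → NLabel IP Data → Set IP → Prop
  | bcast {R m t} : NodeRule ip R (some (.bcast m, t)) (.cast R m, t.map (ip, ·)) R
  | gcast {R D m t} : NodeRule ip R (some (.gcast D m, t)) (.cast (R ∩ D) m, t.map (ip, ·)) R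
  | ucast {R dip m t} : dip ∈ R →
      NodeRule ip R (some (.ucast dip m, t)) (.cast {dip} m, t.map (ip, ·)) R
  | notUcast {R dip m t} : dip ∉ R →
      NodeRule ip R (some (.notUcast dip m, t)) (.tau, t.map (ip, ·)) R
  | deliver {R d t} : NodeRule ip R (some (.deliver d, t)) (.deliver ip d, t.map (ip, ·)) R
  | receive {R m t} : NodeRule ip R (some (.receive m, t)) (.arrive {ip} ∅ m, t.map (ip, ·)) R
  | tau {R t} : NodeRule ip R (some (.tau, t)) (.tau, t.map (ip, ·)) R
  | notArrive {R m} : NodeRule ip R none (.arrive ∅ {ip} m, []) R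
  | connectLeft {R ip'} : NodeRule ip R none (.connect ip ip', []) (R ∪ {ip'})
  | connectRight {R ip'} : NodeRule ip R none (.connect ip' ip, []) (R ∪ {ip'})
  | connectOther {R ip' ip''} : ip ≠ ip' → ip ≠ ip'' →
      NodeRule ip R none (.connect ip' ip'', []) R
  | disconnectLeft {R ip'} : NodeRule ip R none (.disconnect ip ip', []) (R \ {ip'})
  | disconnectRight {R ip'} : NodeRule ip R none (.disconnect ip' ip, []) (R \ {ip'})
  | disconnectOther {R ip' ip''} : ip ≠ ip' → ip ≠ ip'' →
      NodeRule ip R none (.disconnect ip' ip'', []) R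

/-- The rules for the parallel composition of partial networks. -/
inductive NetRule : Option (NLabel IP Data) → Option (NLabel IP Data) → NLabel IP Data → Prop
  | castLeft {R H K m t u} : H ⊆ R → K ∩ R = ∅ →
      NetRule (some (.cast R m, t)) (some (.arrive H K m, u)) (.cast R m, t ++ u)
  | castRight {R H K m t u} : H ⊆ R → K ∩ R = ∅ →
      NetRule (some (.arrive H K m, t)) (some (.cast R m, u)) (.cast R m, t ++ u)
  | arrive {H K H' K' m t u} :
      NetRule (some (.arrive H K m, t)) (some (.arrive H' K' m, u))
        (.arrive (H ∪ H') (K ∪ K') m, t ++ u)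
  | deliverLeft {ip d t} : NetRule (some (.deliver ip d, t)) none (.deliver ip d, t)
  | deliverRight {ip d t} : NetRule none (some (.deliver ip d, t)) (.deliver ip d, t)
  | tauLeft {t} : NetRule (some (.tau, t)) none (.tau, t)
  | tauRight {t} : NetRule none (some (.tau, t)) (.tau, t)
  | connect {ip ip' t u} :
      NetRule (some (.connect ip ip', t)) (some (.connect ip ip', u)) (.connect ip ip', t ++ u)
  | disconnect {ip ip' t u} :
      NetRule (some (.disconnect ip ip', t)) (some (.disconnect ip ip', u))
        (.disconnect ip ip', t ++ u)

/-- Transitions of partial networks. -/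
def PNetStep : PNet IP Data → NLabel IP Data → PNet IP Data → Prop
  | .node ip P R, l, M' => ∃ P' R' o, M' = .node ip P' R' ∧ NodeRule ip R o l R' ∧
      Moves ParStep P o P'
  | .par M N, l, M' => ∃ M₁ N₁ o₁ o₂, M' = .par M₁ N₁ ∧ NetRule o₁ o₂ l ∧
      Moves (fun _ => PNetStep M) M o₁ M₁ ∧ Moves (fun _ => PNetStep N) N o₂ N₁

/-- The rules for the encapsulation operator `[_]`. -/
inductive EncRule : NLabel IP Data → NLabel IP Data → Prop
  | connect {ip ip' t} : EncRule (.connect ip ip', t) (.connect ip ip', t)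
  | disconnect {ip ip' t} : EncRule (.disconnect ip ip', t) (.disconnect ip ip', t)
  | cast {R m t} : EncRule (.cast R m, t) (.tau, t)
  | tau {t} : EncRule (.tau, t) (.tau, t)
  | deliver {ip d t} : EncRule (.deliver ip d, t) (.deliver ip d, t)
  | newpkt {ip K d dip t} : EncRule (.arrive {ip} K (.newpkt d dip), t) (.newpkt ip d dip, t)

/-- Network expressions `[M]`: encapsulated partial networks. -/
structure Net (IP Data : Type) where
  inner : PNet IP Data

/-- Transitions of networks. -/
def NetStep (N : Net IP Data) (l : NLabel IP Data) (N' : Net IP Data) : Prop :=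
  ∃ l', EncRule l' l ∧ PNetStep N.inner l' N'.inner

/-! ### Paths and complete paths -/

/-- A finite (`len = n`) or infinite (`len = ⊤`) sequence of states and moves. Only `st k` with
`k ≤ len` and `act k` with `k < len` are significant. A move `act k = none` is an idle step.

The path of a component of a system is indexed by the steps of the whole system, with an idle step
whenever the component does not take part in a step; the path of the component in the usual sense
results by deleting the idle steps. -/
structure Path (σ α : Type) where
  len : ℕ∞
  st : ℕ → σ
  act : ℕ → Option α

/-- `π` is a path (with idle steps) of the transition system `T`. -/
def Path.Valid {σ α : Type} (T : σ → α → σ → Prop) (π : Path σ α) : Prop :=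
  ∀ k : ℕ, (k : ℕ∞) < π.len → Moves T (π.st k) (π.act k) (π.st (k + 1))

/-- `π`, after deletion of idle steps, is finite and from its last state an internal or output
transition (i.e. one with a label satisfying `out`) is possible. -/
def Path.EndsPrematurely {σ α : Type} (T : σ → α → σ → Prop) (out : α → Prop) (π : Path σ α) :
    Prop :=
  ∃ n : ℕ, (n : ℕ∞) ≤ π.len ∧ (∀ k : ℕ, n ≤ k → (k : ℕ∞) < π.len → π.act k = none) ∧
    ∃ a s, out a ∧ T (π.st n) a s

/-- Internal and output actions of sequential and parallel processes. -/
def Act.IsOut : Act IP Data → Prop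
  | .send _ | .receive _ => False
  | _ => True

/-- Internal and output actions of nodes and (partial) networks. -/
def NAct.IsOut : NAct IP Data → Prop
  | .cast _ _ | .deliver _ _ | .tau => True
  | _ => False

/-- Step-wise composition by the rules `rule`, where the whole idles if both components do. -/
def Combine {α : Type} (rule : Option α → Option α → α → Prop) (o₁ o₂ : Option α) :
    Option α → Prop
  | none => o₁ = none ∧ o₂ = none
  | some a => rule o₁ o₂ a

/-- A complete path of a sequential process. -/
def SeqComplete (π : Path (Val IP Data × SP IP Data) (Act IP Data)) : Prop :=
  π.Valid SeqStep ∧ ¬ π.EndsPrematurely SeqStep Act.IsOut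

/-- `π` derives from complete paths of the sequential processes it is composed of. -/
inductive ParSplit : Path (PP IP Data) (PLabel IP Data) → Prop
  | seq {π π₁} : SeqComplete π₁ → π₁.len = π.len →
      (∀ k : ℕ, (k : ℕ∞) ≤ π.len → π.st k = .seq (π₁.st k)) →
      (∀ k : ℕ, (k : ℕ∞) < π.len → π.act k = (π₁.act k).map fun a => (a, [a])) →
      ParSplit π
  | par {π π₁ π₂} : ParSplit π₁ → ParSplit π₂ → π₁.len = π.len → π₂.len = π.len →
      (∀ k : ℕ, (k : ℕ∞) ≤ π.len → π.st k = .par (π₁.st k) (π₂.st k)) →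
      (∀ k : ℕ, (k : ℕ∞) < π.len → Combine ParRule (π₁.act k) (π₂.act k) (π.act k)) →
      ParSplit π

/-- A complete path of a parallel process. -/
def ParComplete (π : Path (PP IP Data) (PLabel IP Data)) : Prop :=
  π.Valid ParStep ∧ ¬ π.EndsPrematurely ParStep (fun l => l.1.IsOut) ∧ ParSplit π

/-- A complete path of a node expression: it derives from a complete path of the parallel process
running on that node. -/
def NodeComplete (π : Path (PNet IP Data) (NLabel IP Data)) : Prop :=
  π.Valid PNetStep ∧ ¬ π.EndsPrematurely PNetStep (fun l => l.1.IsOut) ∧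
    ∃ (ip : IP) (π₁ : Path (PP IP Data) (PLabel IP Data)) (R : ℕ → Set IP),
      ParComplete π₁ ∧ π₁.len = π.len ∧
      (∀ k : ℕ, (k : ℕ∞) ≤ π.len → π.st k = .node ip (π₁.st k) (R k)) ∧
      (∀ k : ℕ, (k : ℕ∞) < π.len → match π.act k with
        | none => π₁.act k = none ∧ R (k + 1) = R k
        | some l => NodeRule ip (R k) (π₁.act k) l (R (k + 1)))

/-- `π` derives from complete paths of the node expressions it is composed of. -/
inductive NetSplit : Path (PNet IP Data) (NLabel IP Data) → Prop
  | node {π} : NodeComplete π → NetSplit π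
  | par {π π₁ π₂} : NetSplit π₁ → NetSplit π₂ → π₁.len = π.len → π₂.len = π.len →
      (∀ k : ℕ, (k : ℕ∞) ≤ π.len → π.st k = .par (π₁.st k) (π₂.st k)) →
      (∀ k : ℕ, (k : ℕ∞) < π.len → Combine NetRule (π₁.act k) (π₂.act k) (π.act k)) →
      NetSplit π

/-- A complete path of a partial network. -/
def PNetComplete (π : Path (PNet IP Data) (NLabel IP Data)) : Prop :=
  π.Valid PNetStep ∧ ¬ π.EndsPrematurely PNetStep (fun l => l.1.IsOut) ∧ NetSplit π

/-- A complete path of a network. On this level there are no idle steps. -/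
def NetComplete (π : Path (Net IP Data) (NLabel IP Data)) : Prop :=
  π.Valid NetStep ∧ (∀ k : ℕ, (k : ℕ∞) < π.len → π.act k ≠ none) ∧
    ¬ π.EndsPrematurely NetStep (fun l => l.1.IsOut) ∧
    ∃ π₁ : Path (PNet IP Data) (NLabel IP Data), PNetComplete π₁ ∧ π₁.len = π.len ∧
      (∀ k : ℕ, (k : ℕ∞) ≤ π.len → (π.st k).inner = π₁.st k) ∧
      (∀ k : ℕ, (k : ℕ∞) < π.len →
        ∃ l' l, π₁.act k = some l' ∧ π.act k = some l ∧ EncRule l' l)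

/-! ### Initial states -/

/-- The initial valuation of the main process on node `ip`. -/
def initVal (ip : IP) : Val IP Data
  | .ip => some ip
  | .sn => some (1 : ℕ)
  | .rt => some (fun _ => none)
  | .rreqs => some (∅ : Set (IP × ℕ))
  | .store => some (fun _ => none)
  | _ => none

/-- The initial valuation of the message queue process. -/
def initQueueVal : Val IP Data
  | .msgs => some []
  | _ => none

/-- The initial process on node `ip`. -/
def initProc (ip : IP) : PP IP Data :=
  .par (.seq (initVal ip, .callVars .aodv)) (.seq (initQueueVal, .callVars .qmsg))

/-- The addresses of the nodes in a partial network. -/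
def PNet.addrs : PNet IP Data → List IP
  | .node ip _ _ => [ip]
  | .par M N => M.addrs ++ N.addrs

/-- `M.HasNode ip P R`: `ip : P : R` is a node expression of `M`. -/
def PNet.HasNode : PNet IP Data → IP → PP IP Data → Set IP → Prop
  | .node ip P R, ip', P', R' => ip = ip' ∧ P = P' ∧ R = R'
  | .par M N, ip', P', R' => M.HasNode ip' P' R' ∨ N.HasNode ip' P' R'

/-- The initial network expressions of AODV: any finite number of nodes with unique addresses, with
arbitrary ranges, each running its initial process. -/
def IsInitial (N : Net IP Data) : Prop :=
  N.inner.addrs.Nodup ∧ ∀ ip P R, N.inner.HasNode ip P R → P = initProc ip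

/-! ### Linear-time temporal logic -/

/-- What is observed at a position: a state, and possibly a transition (a label with decoration). -/
structure Obs (IP Data : Type) where
  net : Net IP Data
  trans : Option (NLabel IP Data)

/-- LTL formulas. -/
inductive LTL (O : Type)
  | atom (p : O → Prop)
  | neg (φ : LTL O)
  | and (φ ψ : LTL O)
  | or (φ ψ : LTL O)
  | imp (φ ψ : LTL O)
  | G (φ : LTL O)
  | F (φ : LTL O)

/-- Satisfaction at position `i` of a sequence of observations at the positions `0, …, L`. -/
def LTL.Sat {O : Type} (L : ℕ∞) (o : ℕ → O) : LTL O → ℕ → Prop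
  | .atom p, i => p (o i)
  | .neg φ, i => ¬ φ.Sat L o i
  | .and φ ψ, i => φ.Sat L o i ∧ ψ.Sat L o i
  | .or φ ψ, i => φ.Sat L o i ∨ ψ.Sat L o i
  | .imp φ ψ, i => φ.Sat L o i → ψ.Sat L o i
  | .G φ, i => ∀ j : ℕ, i ≤ j → (j : ℕ∞) ≤ L → φ.Sat L o j
  | .F φ, i => ∃ j : ℕ, i ≤ j ∧ (j : ℕ∞) ≤ L ∧ φ.Sat L o j

/-- The observations along a path. A new position `2 * k + 1` is inserted halfway each transition
from state `k` to state `k + 1`; there the transition is observed, together with its target. -/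
def Path.obs (π : Path (Net IP Data) (NLabel IP Data)) (i : ℕ) : Obs IP Data :=
  if i % 2 = 0 then ⟨π.st (i / 2), none⟩ else ⟨π.st (i / 2 + 1), π.act (i / 2)⟩

/-- `π` satisfies the formula `φ`. -/
def Path.Satisfies (π : Path (Net IP Data) (NLabel IP Data)) (φ : LTL (Obs IP Data)) : Prop :=
  φ.Sat (2 * π.len) π.obs 0

/-! ### Atomic propositions -/

/-- `N.Vals ip ξ ζ`: in `N`, the node `ip` has valuation `ξ` of its main process and valuation `ζ`
of its message queue process. -/
def Net.Vals (N : Net IP Data) (ip : IP) (ξ ζ : Val IP Data) : Prop :=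
  ∃ p q R, N.inner.HasNode ip (.par (.seq (ξ, p)) (.seq (ζ, q))) R

/-- `dip ∈ vD^ip`: the node `ip` has a valid route to `dip`. -/
def validRoute (ip dip : IP) : LTL (Obs IP Data) :=
  .atom fun o => ∃ ξ ζ rt, o.net.Vals ip ξ ζ ∧ ξ .rt = some rt ∧ dip ∈ vD rt

/-- `dip ∈ qD^ip`: the node `ip` has queued data packets for `dip`. -/
def queued (ip dip : IP) : LTL (Obs IP Data) :=
  .atom fun o => ∃ ξ ζ store, o.net.Vals ip ξ ζ ∧ ξ .store = some store ∧ dip ∈ qD store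

/-- At node `ip`, the request-required flag for `dip` is set. -/
def requestRequired (ip dip : IP) : LTL (Obs IP Data) :=
  .atom fun o => ∃ ξ ζ store, o.net.Vals ip ξ ζ ∧ ξ .store = some store ∧
    selFlag store dip = some .req

/-- The message queue of the node `ip` is non-empty. -/
def msgsNonempty (ip : IP) : LTL (Obs IP Data) :=
  .atom fun o => ∃ ξ ζ msgs, o.net.Vals ip ξ ζ ∧ ζ .msgs = some msgs ∧ msgs ≠ []

/-- A process on the node `ip` performs an action satisfying `p`. -/
def performs (ip : IP) (p : Act IP Data → Prop) : LTL (Obs IP Data) :=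
  .atom fun o => ∃ l t a, o.trans = some (l, t) ∧ (ip, a) ∈ t ∧ p a

/-- The node `ip` issues a request for a route from `ip` to `dip`. -/
def issuesRreq (ip dip : IP) : LTL (Obs IP Data) :=
  performs ip fun a => ∃ hops rreqid dsn dsk osn,
    a = .bcast (.rreq hops rreqid dip dsn dsk ip osn ip)

/-- The node `ip` tries, successfully or not, to unicast a data packet from `ip` to `dip`. -/
def unicastsPkt (ip dip : IP) : LTL (Obs IP Data) :=
  performs ip fun a => ∃ n data,
    a = .ucast n (.pkt data dip ip) ∨ a = .notUcast n (.pkt data dip ip)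

/-- The message queue process on the node `ip` performs a send action. -/
def sends (ip : IP) : LTL (Obs IP Data) :=
  performs ip fun a => ∃ m, a = .send m

/-- Some link is broken. -/
def disconnects : LTL (Obs IP Data) :=
  .atom fun o => ∃ ip ip' t, o.trans = some (.disconnect ip ip', t)

/-- `y` is a node in the range of the node `x`. -/
def Net.InRange (N : Net IP Data) (x y : IP) : Prop :=
  y ∈ N.inner.addrs ∧ ∃ P R, N.inner.HasNode x P R ∧ y ∈ R

/-- The node `oip` is connected to the node `dip` by a sequence of links. -/
def connected (oip dip : IP) : LTL (Obs IP Data) :=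
  .atom fun o => oip ∈ o.net.inner.addrs ∧ Relation.ReflTransGen o.net.InRange oip dip

/-! ### Fairness and route discovery -/

/-- The fairness component of the specification. -/
def Fair (π : Path (Net IP Data) (NLabel IP Data)) : Prop :=
  (∀ ip dip : IP, π.Satisfies
    (.G (.imp (.G (.and (queued ip dip) (validRoute ip dip))) (.F (unicastsPkt ip dip))))) ∧
  (∀ ip dip : IP, π.Satisfies
    (.G (.imp
      (.G (.and (.and (queued ip dip) (.neg (validRoute ip dip))) (requestRequired ip dip)))
      (.F (issuesRreq ip dip))))) ∧
  (∀ ip : IP, π.Satisfies (.G (.imp (.G (msgsNonempty ip)) (.F (sends ip)))))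

/-- The complete runs of the specification of AODV: complete paths that start in an initial state
and satisfy the fairness component. -/
def IsRun (π : Path (Net IP Data) (NLabel IP Data)) : Prop :=
  IsInitial (π.st 0) ∧ NetComplete π ∧ Fair π

/-- The route discovery formula for the originator `oip` and the destination `dip`. -/
def routeDiscovery (oip dip : IP) : LTL (Obs IP Data) :=
  .G (.imp (.and (connected oip dip) (issuesRreq oip dip)) (.F (.or (validRoute oip dip) disconnects)))

/-- AODV satisfies the property route discovery. -/
def SatisfiesRouteDiscovery (IP Data : Type) : Prop :=
  ∀ (oip dip : IP) (π : Path (Net IP Data) (NLabel IP Data)),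
    IsRun π → π.Satisfies (routeDiscovery oip dip)

/-- The initial state with three nodes in the linear topology `s — a — d`. -/
def lineNet (s a d : IP) : Net IP Data :=
  ⟨.par (.node s (initProc s) {a}) (.par (.node a (initProc a) {s, d}) (.node d (initProc d) {a}))⟩

/-- In the step from `N` to `N'`, the node `ip` silently drops a route reply for the originator
`oip`, another node, concerning the destination `dip`, because the reply does not improve its
routing table: its main process returns from the routine for handling route replies to the basic
routine at once, without forwarding the reply. -/
def DropsRrep (ip oip dip : IP) (N N' : Net IP Data) : Prop :=
  oip ≠ ip ∧ ∃ ξ ξ' ζ ζ' q q' R R',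
    N.inner.HasNode ip (.par (.seq (ξ, .callVars .rrep)) (.seq (ζ, q))) R ∧
    N'.inner.HasNode ip (.par (.seq (ξ', .callVars .aodv)) (.seq (ζ', q'))) R' ∧
    ξ .oip = some oip ∧ ξ .dip = some dip ∧ ξ .rt ≠ none ∧ rrepUpdate ξ = ξ .rt

end AODV

/-! The failure comes from the fact that answering a route request does not increase the sequence
number of the destination. Let `s` request a route to `d`, and let `a` forward the request. Before
`d` handles the forwarded copy, it issues a request of its own for `a`, which raises its sequence
number from 1 to 2. From that request `a` learns a one-hop route to `d` with number 2. When `d` then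
answers `s`, the reply carries number 2 again and offers `a` a one-hop route again. The table of `a`
does not change, so `a` discards the reply instead of forwarding it. At `s` the request-required
flag was cleared when the request was sent, so fairness does not force a second request.

The order of events matters. `a` has to treat the request of `s` before that of `d`, since otherwise
it would answer `s` itself. `d` has to issue its request before treating the forwarded one, since
that one gives it a valid route to `a`.

`lost_reply` plays this finite scenario up to a configuration in which all nodes are in the basic
routine with empty queues and no premise of (F₁) or (F₂) holds. From there data packets are injected
forever at their own destinations and delivered at once (`exists_cycle`), and
`Trace.exists_infinite` glues everything to an infinite run. Every sequential process acts
infinitely often, so no component path ends prematurely and the run is complete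
(`netComplete_of_lineStep`). (F₁) and (F₂) hold because their premises fail at the recurring idle
states, and (F₃) holds because each queue sends infinitely often.

That `s` never has a route to `d` must be known at all intermediate states, so every single
transition is required to preserve it (`LineStepKeeps` with `noRoute`). The scenario is composed
from relations `Leads` between predicates on states, not between states, because valuations carry
irrelevant leftovers of earlier messages. -/

namespace AODV

/-! ### Finite and infinite runs of labelled transition relations -/

section Traces

variable {G M ι : Type}

/-- `Trace step g p g'`: the list `p` of transitions leads from `g` to `g'`. -/
inductive Trace (step : G → M → G → Prop) : G → List (G × M × G) → G → Prop
  | nil {g} : Trace step g [] g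
  | cons {g m g' p g''} : step g m g' → Trace step g' p g'' →
      Trace step g ((g, m, g') :: p) g''

variable {step : G → M → G → Prop}

theorem Trace.single {g m g'} (h : step g m g') : Trace step g [(g, m, g')] g' :=
  .cons h .nil

theorem Trace.append {g p g' q g''} (h : Trace step g p g') (h' : Trace step g' q g'') :
    Trace step g (p ++ q) g'' := by
  induction h with
  | nil => exact h'
  | cons hs _ ih => exact .cons hs (ih h')

/-- If every state in `T` starts a non-empty trace back to `T` in which all the events `E i` occur,
then every trace to a state in `T` extends to an infinite run with infinitely many such events. -/
theorem Trace.exists_infinite {T : G → Prop} {E : ι → G × M × G → Prop}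
    (h : ∀ g, T g → ∃ p g', p ≠ [] ∧ Trace step g p g' ∧ T g' ∧ ∀ i, ∃ e ∈ p, E i e)
    {g p g'} (hp : Trace step g p g') (hT : T g') :
    ∃ (st : ℕ → G) (act : ℕ → M), st 0 = g ∧ (∀ k, step (st k) (act k) (st (k + 1))) ∧
      (∀ e ∈ p, ∃ k, e = (st k, act k, st (k + 1))) ∧
      ∀ i n, ∃ k, n ≤ k ∧ E i (st k, act k, st (k + 1)) := by
  -- A state together with the non-empty list of transitions still to be performed. Performing the
  -- head gives a successor of the same kind; a fresh cycle is loaded when the list would run empty.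
  let X := {x : G × List (G × M × G) // x.2 ≠ [] ∧ ∃ g', Trace step x.1 x.2 g' ∧ T g'}
  have hnext : ∀ x : X, ∃ (m : M) (y : X), step x.1.1 m y.1.1 ∧
      ∃ q, x.1.2 = (x.1.1, m, y.1.1) :: q ∧ (q = [] ∧ (∀ i, ∃ e ∈ y.1.2, E i e) ∨ q = y.1.2) := by
    rintro ⟨⟨g, p⟩, hne, g', ht, hg'⟩
    change Trace step g p g' at ht
    cases ht with
    | nil => exact absurd rfl hne
    | @cons _ m g₁ q _ hs ht =>
      by_cases hq : q = []
      · subst hq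
        cases ht
        obtain ⟨p', g₂, hne', ht', hT', hE⟩ := h _ hg'
        exact ⟨m, ⟨(g', p'), hne', g₂, ht', hT'⟩, hs, [], rfl, .inl ⟨rfl, hE⟩⟩
      · exact ⟨m, ⟨(g₁, q), hq, g', ht, hg'⟩, hs, q, rfl, .inr rfl⟩
  choose act next hstep q hq hq' using hnext
  -- One cycle is appended at the start, since `p` itself may be empty.
  obtain ⟨p₀, g₀, hne, ht, hT₀, -⟩ := h _ hT
  let x : ℕ → X := Nat.rec ⟨(g, p ++ p₀), by simp [hne], g₀, hp.append ht, hT₀⟩ fun _ => next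
  have hx : ∀ k, x (k + 1) = next (x k) := fun _ => rfl
  -- The list is consumed from the front and never altered before it runs out, so everything
  -- scheduled is performed.
  have occurs : ∀ (r : List (G × M × G)) (n : ℕ), (x n).1.2 = r → ∀ e ∈ r,
      ∃ k, n ≤ k ∧ e = ((x k).1.1, act (x k), (x (k + 1)).1.1) := by
    intro r
    induction r with
    | nil => simp
    | cons a r ih =>
      intro n hn e he
      have h1 := hq (x n)
      rw [hn] at h1
      obtain ⟨ha, hr⟩ := List.cons.inj h1
      rcases List.mem_cons.1 he with rfl | he
      · exact ⟨n, le_rfl, ha⟩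
      · rcases hq' (x n) with ⟨h2, -⟩ | h2
        · rw [hr, h2] at he
          simp at he
        · obtain ⟨k, hk, hk'⟩ := ih (n + 1) (by rw [hx, ← h2, hr]) e he
          exact ⟨k, by omega, hk'⟩
  -- The list shrinks at each step until a full cycle replaces it, so complete cycles are loaded
  -- infinitely often.
  have renew : ∀ (r : List (G × M × G)) (n : ℕ), (x n).1.2 = r →
      ∃ k, n ≤ k ∧ ∀ i, ∃ e ∈ (x k).1.2, E i e := by
    intro r
    induction r with
    | nil => exact fun n hn => absurd hn (x n).2.1
    | cons a r ih =>
      intro n hn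
      have h1 := hq (x n)
      rw [hn] at h1
      obtain ⟨ha, hr⟩ := List.cons.inj h1
      rcases hq' (x n) with ⟨-, h2⟩ | h2
      · exact ⟨n + 1, by omega, h2⟩
      · obtain ⟨k, hk, hk'⟩ := ih (n + 1) (by rw [hx, ← h2, hr])
        exact ⟨k, by omega, hk'⟩
  refine ⟨fun k => (x k).1.1, fun k => act (x k), rfl, fun k => hstep (x k), ?_, ?_⟩
  · intro e he
    obtain ⟨k, -, hk⟩ := occurs _ 0 rfl e (List.mem_append_left _ he)
    exact ⟨k, hk⟩
  · intro i n
    obtain ⟨k, hk, hE⟩ := renew _ n rfl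
    obtain ⟨e, he, hEe⟩ := hE i
    obtain ⟨j, hj, rfl⟩ := occurs _ k rfl e he
    exact ⟨j, hk.trans hj, hEe⟩

end Traces

/-! ### Networks of three nodes -/

section Line

variable {IP Data : Type}

/-- A state of a sequential process. -/
abbrev SState (IP Data : Type) := Val IP Data × SP IP Data

/-- The states of the main process and of the message queue process of each of the three nodes. -/
abbrev LineState (IP Data : Type) := Fin 3 → SState IP Data × SState IP Data

/-- What the main processes and the message queue processes do in a transition, and the label of the
transition. -/
structure LineMove (IP Data : Type) where
  om : Fin 3 → Option (Act IP Data)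
  oq : Fin 3 → Option (Act IP Data)
  lab : NLabel IP Data

/-- The parallel process of a node. -/
def LineState.proc (g : LineState IP Data) (i : Fin 3) : PP IP Data :=
  .par (.seq (g i).1) (.seq (g i).2)

/-- The network expression with nodes with addresses `ad` and ranges `R`. -/
def LineState.net (ad : Fin 3 → IP) (R : Fin 3 → Set IP) (g : LineState IP Data) : Net IP Data :=
  ⟨.par (.node (ad 0) (g.proc 0) (R 0))
    (.par (.node (ad 1) (g.proc 1) (R 1)) (.node (ad 2) (g.proc 2) (R 2)))⟩

/-- The decoration of an action of a sequential process. -/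
def decorate (o : Option (Act IP Data)) : Option (PLabel IP Data) := o.map fun a => (a, [a])

/-- Transitions of a network of three nodes that do not change the topology. -/
def LineStep (ad : Fin 3 → IP) (R : Fin 3 → Set IP) (g : LineState IP Data)
    (m : LineMove IP Data) (g' : LineState IP Data) : Prop :=
  (∀ i, Moves SeqStep (g i).1 (m.om i) (g' i).1) ∧
  (∀ i, Moves SeqStep (g i).2 (m.oq i) (g' i).2) ∧
  (∀ x y t, m.lab ≠ (.connect x y, t) ∧ m.lab ≠ (.disconnect x y, t)) ∧
  ∃ (o : Fin 3 → Option (PLabel IP Data)) (l : Fin 3 → Option (NLabel IP Data))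
      (l₁₂ : Option (NLabel IP Data)) (l' : NLabel IP Data),
    (∀ i, Combine ParRule (decorate (m.om i)) (decorate (m.oq i)) (o i)) ∧
    (∀ i, match l i with
      | none => o i = none
      | some l => NodeRule (ad i) (R i) (o i) l (R i)) ∧
    Combine NetRule (l 1) (l 2) l₁₂ ∧ NetRule (l 0) l₁₂ l' ∧ EncRule l' m.lab

/-- After deletion of idle steps such a path is still infinite and has no last state, so it does not
matter which transitions are enabled. -/
theorem Path.not_endsPrematurely {σ α : Type} {T : σ → α → σ → Prop} {out : α → Prop}
    {π : Path σ α} (hl : π.len = ⊤) (h : ∀ n, ∃ k, n ≤ k ∧ π.act k ≠ none) :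
    ¬ π.EndsPrematurely T out := by
  rintro ⟨n, -, hn, -⟩
  obtain ⟨k, hk, hk'⟩ := h n
  exact hk' (hn k hk (by simp [hl]))

variable {ad : Fin 3 → IP} {R : Fin 3 → Set IP}

/-- An infinite run of a network of three nodes in which every main process and every message queue
process acts infinitely often is complete. -/
theorem netComplete_of_lineStep {st : ℕ → LineState IP Data} {mv : ℕ → LineMove IP Data}
    (hs : ∀ k, LineStep ad R (st k) (mv k) (st (k + 1)))
    (hinf : ∀ i n, ∃ k, n ≤ k ∧ (mv k).om i ≠ none ∧ (mv k).oq i ≠ none) :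
    NetComplete ⟨⊤, fun k => (st k).net ad R, fun k => some (mv k).lab⟩ := by
  -- The labels of all subsystems at all times: they are the actions of the component paths that
  -- justness asks for.
  choose hm hq _ o l l₁₂ l' ho hl hl₁₂ hl' he using hs
  -- Activity propagates upwards: a composition idles only if both of its components do.
  have ho' : ∀ i k, (mv k).om i ≠ none → o k i ≠ none := by
    intro i k h h'
    have := ho k i
    rw [h'] at this
    exact h (by simpa [decorate] using this.1)
  have hln : ∀ i k, (mv k).om i ≠ none → l k i ≠ none := by
    intro i k h h'
    have := hl k i
    rw [h'] at this
    exact ho' i k h this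
  have hl₁₂n : ∀ k, (mv k).om 1 ≠ none → l₁₂ k ≠ none := by
    intro k h h'
    have := hl₁₂ k
    rw [h'] at this
    exact hln 1 k h this.1
  have inf : ∀ {σ α : Type} (i : Fin 3) (act : ℕ → Option α),
      (∀ k, (mv k).om i ≠ none → act k ≠ none) → ∀ n : ℕ, ∃ k, n ≤ k ∧ act k ≠ none := by
    intro _ _ i act h n
    obtain ⟨k, hk, h1, -⟩ := hinf i n
    exact ⟨k, hk, h k h1⟩
  have seqM : ∀ i, SeqComplete ⟨⊤, fun k => (st k i).1, fun k => (mv k).om i⟩ := fun i =>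
    ⟨fun k _ => hm k i, Path.not_endsPrematurely rfl fun n => by
      obtain ⟨k, hk, h1, -⟩ := hinf i n
      exact ⟨k, hk, h1⟩⟩
  have seqQ : ∀ i, SeqComplete ⟨⊤, fun k => (st k i).2, fun k => (mv k).oq i⟩ := fun i =>
    ⟨fun k _ => hq k i, Path.not_endsPrematurely rfl fun n => by
      obtain ⟨k, hk, -, h1⟩ := hinf i n
      exact ⟨k, hk, h1⟩⟩
  have lift : ∀ {s s' : SState IP Data} {o : Option (Act IP Data)}, Moves SeqStep s o s' →
      Moves ParStep (.seq s) (decorate o) (.seq s') := by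
    intro s s' o h
    cases o with
    | none => exact congrArg _ h
    | some a => exact ⟨s', rfl, rfl, h⟩
  have parV : ∀ i k, Moves ParStep ((st k).proc i) (o k i) ((st (k + 1)).proc i) := by
    intro i k
    have h := ho k i
    cases hoi : o k i with
    | none =>
      rw [hoi] at h
      have h1 := hm k i
      have h2 := hq k i
      simp only [Combine, decorate, Option.map_eq_none_iff] at h
      rw [h.1] at h1
      rw [h.2] at h2
      simp only [Moves] at h1 h2
      simp only [Moves, LineState.proc, h1, h2]
    | some a =>
      rw [hoi] at h
      refine ⟨_, _, _, _, rfl, h, ?_, ?_⟩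
      · have := lift (hm k i)
        revert this
        cases decorate ((mv k).om i) <;> exact id
      · have := lift (hq k i)
        revert this
        cases decorate ((mv k).oq i) <;> exact id
  have par : ∀ i, ParComplete ⟨⊤, fun k => (st k).proc i, fun k => o k i⟩ := fun i =>
    ⟨fun k _ => parV i k, Path.not_endsPrematurely rfl (inf (σ := IP) i _ (ho' i)),
      .par (π₁ := ⟨⊤, fun k => .seq (st k i).1, fun k => decorate ((mv k).om i)⟩)
        (π₂ := ⟨⊤, fun k => .seq (st k i).2, fun k => decorate ((mv k).oq i)⟩)
        (.seq (seqM i) rfl (fun _ _ => rfl) fun _ _ => rfl)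
        (.seq (seqQ i) rfl (fun _ _ => rfl) fun _ _ => rfl) rfl rfl
        (fun _ _ => rfl) fun k _ => ho k i⟩
  have nodeV : ∀ i k, Moves PNetStep (.node (ad i) ((st k).proc i) (R i)) (l k i)
      (.node (ad i) ((st (k + 1)).proc i) (R i)) := by
    intro i k
    have h := hl k i
    have h1 := parV i k
    cases hli : l k i with
    | none =>
      rw [hli] at h
      dsimp only at h
      rw [h] at h1
      exact congrArg (PNet.node (ad i) · (R i)) h1
    | some a =>
      rw [hli] at h
      exact ⟨_, _, _, rfl, h, h1⟩
  have node : ∀ i, NodeComplete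
      ⟨⊤, fun k => .node (ad i) ((st k).proc i) (R i), fun k => l k i⟩ := fun i =>
    ⟨fun k _ => nodeV i k, Path.not_endsPrematurely rfl (inf (σ := IP) i _ (hln i)),
      ad i, _, fun _ => R i, par i, rfl, fun _ _ => rfl, fun k _ => by
        have h := hl k i
        dsimp only
        cases hli : l k i with
        | none =>
          rw [hli] at h
          exact ⟨h, rfl⟩
        | some a =>
          rw [hli] at h
          exact h⟩
  have V₁₂ : ∀ k, Moves PNetStep
      (.par (.node (ad 1) ((st k).proc 1) (R 1)) (.node (ad 2) ((st k).proc 2) (R 2))) (l₁₂ k)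
      (.par (.node (ad 1) ((st (k + 1)).proc 1) (R 1))
        (.node (ad 2) ((st (k + 1)).proc 2) (R 2))) := by
    intro k
    have h := hl₁₂ k
    have h1 := nodeV 1 k
    have h2 := nodeV 2 k
    cases hli : l₁₂ k with
    | none =>
      rw [hli] at h
      rw [h.1] at h1
      rw [h.2] at h2
      simp only [Moves] at h1 h2 ⊢
      rw [h1, h2]
    | some a =>
      rw [hli] at h
      refine ⟨_, _, _, _, rfl, h, ?_, ?_⟩
      · revert h1
        cases l k 1 <;> exact id
      · revert h2
        cases l k 2 <;> exact id
  have V : ∀ k, PNetStep ((st k).net ad R).inner (l' k) ((st (k + 1)).net ad R).inner := by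
    intro k
    have h1 := nodeV 0 k
    have h2 := V₁₂ k
    refine ⟨_, _, _, _, rfl, hl' k, ?_, ?_⟩
    · revert h1
      cases l k 0 <;> exact id
    · revert h2
      cases l₁₂ k <;> exact id
  refine ⟨fun k _ => ⟨l' k, he k, V k⟩, by simp, Path.not_endsPrematurely rfl (by simpa using
    fun n => ⟨n, le_rfl⟩),
    ⟨⊤, fun k => ((st k).net ad R).inner, fun k => some (l' k)⟩, ⟨fun k _ => V k,
      Path.not_endsPrematurely rfl (by simpa using fun n => ⟨n, le_rfl⟩), ?_⟩, rfl, fun _ _ => rfl,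
      fun k _ => ⟨_, _, rfl, rfl, he k⟩⟩
  -- `NetSplit` demands completeness only of the nodes, not of the inner pair.
  refine .par (.node (node 0)) (.par (π := ⟨⊤, _, l₁₂⟩) (.node (node 1)) (.node (node 2)) rfl rfl
    (fun _ _ => rfl)
    fun k _ => hl₁₂ k) rfl rfl (fun _ _ => rfl) fun k _ => hl' k

end Line

/-! ### Assembling network transitions from the contributions of the nodes -/

section LineSteps

variable {IP Data : Type} {ad : Fin 3 → IP} {R : Fin 3 → Set IP}

/-- The contribution of the node `i` to a transition. -/
def NodeMoves (ad : Fin 3 → IP) (R : Fin 3 → Set IP) (g g' : LineState IP Data) (i : Fin 3)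
    (om oq : Option (Act IP Data)) (l : Option (NLabel IP Data)) : Prop :=
  Moves SeqStep (g i).1 om (g' i).1 ∧ Moves SeqStep (g i).2 oq (g' i).2 ∧
    ∃ o, Combine ParRule (decorate om) (decorate oq) o ∧ match l with
      | none => o = none
      | some l => NodeRule (ad i) (R i) o l (R i)

theorem lineStep_of_nodeMoves {g g' : LineState IP Data} {om oq : Fin 3 → Option (Act IP Data)}
    {l : Fin 3 → Option (NLabel IP Data)} {l₁₂ l' lab} (h : ∀ i, NodeMoves ad R g g' i (om i) (oq i)
      (l i))
    (h₁₂ : Combine NetRule (l 1) (l 2) l₁₂) (h' : NetRule (l 0) l₁₂ l') (he : EncRule l' lab)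
    (hlab : ∀ x y t, lab ≠ (.connect x y, t) ∧ lab ≠ (.disconnect x y, t)) :
    LineStep ad R g ⟨om, oq, lab⟩ g' := by
  choose hm hq o ho hl using h
  exact ⟨hm, hq, hlab, o, l, l₁₂, l', ho, hl, h₁₂, h', he⟩

theorem NodeMoves.idle {g g' : LineState IP Data} {i : Fin 3} (h : g' i = g i) :
    NodeMoves ad R g g' i none none none :=
  ⟨by rw [h]; rfl, by rw [h]; rfl, none, ⟨rfl, rfl⟩, rfl⟩

/-- Every node takes part in a transmission; one that is not reached contributes the label that the
message did not arrive. -/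
theorem NodeMoves.notArrive {g g' : LineState IP Data} {i : Fin 3} (h : g' i = g i)
    (m : Msg IP Data) : NodeMoves ad R g g' i none none (some (.arrive ∅ {ad i} m, [])) :=
  ⟨by rw [h]; rfl, by rw [h]; rfl, none, ⟨rfl, rfl⟩, .notArrive⟩

/-- `ParRule.left` excludes receive actions, so a message from outside can only be received by the
queue process, the right component. -/
theorem NodeMoves.arrive {g g' : LineState IP Data} {i : Fin 3} {m : Msg IP Data}
    (h : (g' i).1 = (g i).1) (h' : SeqStep (g i).2 (.receive m) (g' i).2) :
    NodeMoves ad R g g' i none (some (.receive m))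
      (some (.arrive {ad i} ∅ m, [(ad i, .receive m)])) :=
  ⟨h, h', some (.receive m, [.receive m]), .right (by simp), .receive⟩

/-- A transition of a single node. -/
theorem LineStep.local {g g' : LineState IP Data} {i : Fin 3} {om oq l}
    (h : NodeMoves ad R g g' i om oq (some l)) (hne : ∀ j, j ≠ i → g' j = g j)
    (hl : (∃ t, l = (.tau, t)) ∨ ∃ ip d t, l = (.deliver ip d, t)) :
    LineStep ad R g ⟨Function.update (fun _ => none) i om, Function.update (fun _ => none) i oq, l⟩
      g' := by
  refine lineStep_of_nodeMoves (l := Function.update (fun _ => none) i (some l))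
    (l₁₂ := if i = 0 then none else some l) (l' := l) ?_ ?_ ?_ ?_ ?_
  · intro j
    by_cases hj : j = i
    · subst hj
      simpa using h
    · simpa [hj] using NodeMoves.idle (hne j hj)
  · rcases hl with ⟨t, rfl⟩ | ⟨ip, d, t, rfl⟩ <;> fin_cases i <;> simp [Combine, Function.update]
      <;> constructor
  · rcases hl with ⟨t, rfl⟩ | ⟨ip, d, t, rfl⟩ <;> fin_cases i <;> simp [Function.update] <;>
      constructor
  · rcases hl with ⟨t, rfl⟩ | ⟨ip, d, t, rfl⟩ <;> constructor
  · rcases hl with ⟨t, rfl⟩ | ⟨ip, d, t, rfl⟩ <;> simp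

/-- The injection of a new data packet. -/
theorem LineStep.newpkt {g g' : LineState IP Data} {i : Fin 3} {d : Data} {dip : IP}
    (hm : (g' i).1 = (g i).1) (hq : SeqStep (g i).2 (.receive (.newpkt d dip)) (g' i).2)
    (hne : ∀ j, j ≠ i → g' j = g j) : ∃ mv, LineStep ad R g mv g' := by
  have h := NodeMoves.arrive (ad := ad) (R := R) hm hq
  have h' : ∀ j, j ≠ i → _ := fun j hj => NodeMoves.notArrive (ad := ad) (R := R) (hne j hj)
    (.newpkt d dip)
  obtain rfl | rfl | rfl : i = 0 ∨ i = 1 ∨ i = 2 := by fin_cases i <;> simp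
  -- The receivers come out as a union of a singleton with empty sets, which `simpa` collapses to
  -- the singleton required by the encapsulation rule.
  · exact ⟨⟨![_, _, _], ![_, _, _], (.newpkt (ad 0) d dip, _)⟩, lineStep_of_nodeMoves
      (l := ![_, _, _])
      (by intro i; fin_cases i; exacts [h, h' 1 (by decide), h' 2 (by decide)])
      (l₁₂ := some _) NetRule.arrive NetRule.arrive (by simpa using EncRule.newpkt) (by simp)⟩
  · exact ⟨⟨![_, _, _], ![_, _, _], (.newpkt (ad 1) d dip, _)⟩, lineStep_of_nodeMoves
      (l := ![_, _, _])
      (by intro i; fin_cases i; exacts [h' 0 (by decide), h, h' 2 (by decide)])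
      (l₁₂ := some _) NetRule.arrive NetRule.arrive (by simpa using EncRule.newpkt) (by simp)⟩
  · exact ⟨⟨![_, _, _], ![_, _, _], (.newpkt (ad 2) d dip, _)⟩, lineStep_of_nodeMoves
      (l := ![_, _, _])
      (by intro i; fin_cases i; exacts [h' 0 (by decide), h' 1 (by decide), h])
      (l₁₂ := some _) NetRule.arrive NetRule.arrive (by simpa using EncRule.newpkt) (by simp)⟩

/-- A message is sent by the main process of node `i`, and received by the message queues of the
nodes in `D`. -/
theorem LineStep.cast {g g' : LineState IP Data} {i : Fin 3} {a : Act IP Data} {D : Set IP}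
    {m : Msg IP Data} (hs : SeqStep (g i).1 a (g' i).1) (hq : (g' i).2 = (g i).2)
    (ha : ∀ m, a ≠ .receive m)
    (hn : NodeRule (ad i) (R i) (some (a, [a])) (.cast D m, [(ad i, a)]) (R i))
    (hne : ∀ j, j ≠ i → ad j ∈ D ∧ (g' j).1 = (g j).1 ∧ SeqStep (g j).2 (.receive m) (g' j).2 ∨
      ad j ∉ D ∧ g' j = g j) :
    ∃ mv t, LineStep ad R g mv g' ∧ mv.lab = (.tau, t) ∧ (ad i, a) ∈ t := by
  have h : NodeMoves ad R g g' i (some a) none (some (.cast D m, [(ad i, a)])) :=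
    ⟨hs, hq, some _, ParRule.left ha, hn⟩
  -- Receivers lie in `D` and non-receivers outside it: the side conditions of the cast rules, in a
  -- form stable under unions.
  have h' : ∀ j, j ≠ i → ∃ oq H K u, NodeMoves ad R g g' j none oq (some (.arrive H K m, u)) ∧
      H ⊆ D ∧ K ∩ D = ∅ := by
    intro j hj
    rcases hne j hj with ⟨h1, h2, h3⟩ | ⟨h1, h2⟩
    · exact ⟨_, _, _, _, .arrive h2 h3, by simpa using h1, by simp⟩
    · exact ⟨_, _, _, _, .notArrive h2 m, by simp, by simpa using h1⟩
  have hlab : ∀ (t : List (IP × Act IP Data)) x y u, ((.tau, t) : NLabel IP Data) ≠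
    (.connect x y, u) ∧
    ((.tau, t) : NLabel IP Data) ≠ (.disconnect x y, u) := by simp
  have union : ∀ {H K : Set IP}, H ∩ D = ∅ → K ∩ D = ∅ → (H ∪ K) ∩ D = ∅ := by
    intro H K h1 h2
    rw [Set.union_inter_distrib_right, h1, h2, Set.union_empty]
  obtain rfl | rfl | rfl : i = 0 ∨ i = 1 ∨ i = 2 := by fin_cases i <;> simp
  · obtain ⟨q₁, H₁, K₁, u₁, h₁, hH₁, hK₁⟩ := h' 1 (by decide)
    obtain ⟨q₂, H₂, K₂, u₂, h₂, hH₂, hK₂⟩ := h' 2 (by decide)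
    exact ⟨_, _, lineStep_of_nodeMoves (om := ![_, _, _]) (oq := ![_, _, _]) (l := ![_, _, _])
      (by intro i; fin_cases i; exacts [h, h₁, h₂])
      (l₁₂ := some _) (NetRule.arrive (H := H₁) (K := K₁) (H' := H₂) (K' := K₂) (t := u₁) (u := u₂)
        (m := m))
      (.castLeft (Set.union_subset hH₁ hH₂) (union hK₁ hK₂)) .cast (hlab _), rfl, by simp⟩
  · obtain ⟨q₁, H₁, K₁, u₁, h₁, hH₁, hK₁⟩ := h' 0 (by decide)
    obtain ⟨q₂, H₂, K₂, u₂, h₂, hH₂, hK₂⟩ := h' 2 (by decide)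
    exact ⟨_, _, lineStep_of_nodeMoves (om := ![_, _, _]) (oq := ![_, _, _]) (l := ![_, _, _])
      (by intro i; fin_cases i; exacts [h₁, h, h₂])
      (l₁₂ := some _) (NetRule.castLeft (H := H₂) (K := K₂) (t := [(ad 1, a)]) (u := u₂) (m := m)
        hH₂ hK₂)
      (.castRight (t := u₁) hH₁ hK₁) .cast (hlab _), rfl, by simp⟩
  · obtain ⟨q₁, H₁, K₁, u₁, h₁, hH₁, hK₁⟩ := h' 0 (by decide)
    obtain ⟨q₂, H₂, K₂, u₂, h₂, hH₂, hK₂⟩ := h' 1 (by decide)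
    exact ⟨_, _, lineStep_of_nodeMoves (om := ![_, _, _]) (oq := ![_, _, _]) (l := ![_, _, _])
      (by intro i; fin_cases i; exacts [h₁, h₂, h])
      (l₁₂ := some _) (NetRule.castRight (H := H₂) (K := K₂) (t := u₂) (u := [(ad 2, a)]) (m := m)
        hH₂ hK₂)
      (.castRight (t := u₁) hH₁ hK₁) .cast (hlab _), rfl, by simp⟩

end LineSteps

/-! ### The message queue -/

section Queue

variable {IP Data : Type}

/-- The message queue process is about to proceed with the queue `msgs`. -/
def QueueAt (msgs : List (Msg IP Data)) (s : SState IP Data) : Prop :=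
  ∃ ζ args, s = (ζ, .call .qmsg args) ∧ args .msgs ζ = some msgs

theorem Extends.refl {fv : Set Var} {φ : Val IP Data → Prop} {ξ : Val IP Data}
    (h : ∀ v ∈ fv, ξ v ≠ none) (hφ : φ ξ) : Extends fv φ ξ ξ :=
  ⟨fun _ _ => rfl, fun _ h _ => h, h, hφ⟩

/-- The first summand of the queue process can always receive, so a queue never blocks a
transmission. -/
theorem QueueAt.receive {msgs : List (Msg IP Data)} {s : SState IP Data} (h : QueueAt msgs s)
    (m : Msg IP Data) : ∃ s', SeqStep s (.receive m) s' ∧ QueueAt (msgs ++ [m]) s' := by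
  obtain ⟨ζ, args, rfl, h⟩ := h
  refine ⟨_, .call ?_ (.choiceLeft (.receive m)), _, _, rfl, ?_⟩
  · simp [params, h]
  · simp [bindArgs, params, h]

/-- Passing the non-emptiness guard is an internal step of its own. The state after it is no longer
at a call, so both steps are taken together. -/
theorem QueueAt.send {m : Msg IP Data} {msgs : List (Msg IP Data)} {s : SState IP Data}
    (h : QueueAt (m :: msgs) s) :
    ∃ s₁ s₂, SeqStep s .tau s₁ ∧ SeqStep s₁ (.send m) s₂ ∧ QueueAt msgs s₂ := by
  obtain ⟨ζ, args, rfl, h⟩ := h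
  have hb : bindArgs .qmsg args ζ .msgs = some (m :: msgs) := by simp [bindArgs, params, h]
  refine ⟨_, _, .call ?_ (.choiceRight (.guard (.refl ?_ ⟨_, hb, by simp⟩))),
    .choiceLeft (.send ?_), _, _, rfl, ?_⟩
  · simp [params, h]
  · simp [hb]
  · simp [hb]
  · simp [hb]

end Queue

/-! ### Configurations of a network of three nodes -/

section Conf

variable {IP Data : Type}

/-- For each node a property of the state of the main process, and the content of the message
queue. -/
abbrev Conf (IP Data : Type) := Fin 3 → (SState IP Data → Prop) × List (Msg IP Data)

def Conf.At (K : Conf IP Data) (g : LineState IP Data) : Prop :=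
  ∀ i, (K i).1 (g i).1 ∧ QueueAt (K i).2 (g i).2

/-- All routing tables occurring in the valuation are in `J`. -/
def Keeps (J : Set (RT IP)) (ξ : Val IP Data) : Prop := ∀ rt, ξ .rt = some rt → rt ∈ J

/-- Internal steps of a sequential process. -/
def SeqTau (J : Set (RT IP)) : SState IP Data → SState IP Data → Prop :=
  Relation.ReflTransGen fun s s' => SeqStep s .tau s' ∧ Keeps J s'.1

/-- A transition that keeps the routing table of each node `i` in `J i`. -/
def LineStepKeeps (ad : Fin 3 → IP) (R : Fin 3 → Set IP) (J : Fin 3 → Set (RT IP))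
    (g : LineState IP Data) (m : LineMove IP Data) (g' : LineState IP Data) : Prop :=
  LineStep ad R g m g' ∧ ((∀ i, Keeps (J i) (g i).1.1) → ∀ i, Keeps (J i) (g' i).1.1)

abbrev Event (IP Data : Type) := LineState IP Data × LineMove IP Data × LineState IP Data → Prop

/-- Each state in the configuration `K` has a trace, in which the events `E` occur, to a state in
the configuration `K'`. -/
def Leads (ad : Fin 3 → IP) (R : Fin 3 → Set IP) (J : Fin 3 → Set (RT IP))
    (E : List (Event IP Data)) (K K' : Conf IP Data) : Prop :=
  ∀ g, K.At g → ∃ p g', Trace (LineStepKeeps ad R J) g p g' ∧ K'.At g' ∧ ∀ ε ∈ E, ∃ e ∈ p, ε e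

variable {ad : Fin 3 → IP} {R : Fin 3 → Set IP} {J : Fin 3 → Set (RT IP)}

theorem Leads.trans {E E' : List (Event IP Data)} {K K' K'' : Conf IP Data}
    (h : Leads ad R J E K K') (h' : Leads ad R J E' K' K'') : Leads ad R J (E ++ E') K K'' := by
  intro g hg
  obtain ⟨p, g', hp, hg', hE⟩ := h g hg
  obtain ⟨p', g'', hp', hg'', hE'⟩ := h' g' hg'
  refine ⟨_, _, hp.append hp', hg'', fun ε hε => ?_⟩
  rcases List.mem_append.1 hε with hε | hε
  · obtain ⟨e, he, h⟩ := hE ε hε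
    exact ⟨e, List.mem_append_left _ he, h⟩
  · obtain ⟨e, he, h⟩ := hE' ε hε
    exact ⟨e, List.mem_append_right _ he, h⟩

/-- The main process of node `i` takes a message from its queue. -/
def SyncEvent (ad : Fin 3 → IP) (i : Fin 3) : Event IP Data := fun e =>
  e.2.1.om i ≠ none ∧ e.2.1.oq i ≠ none ∧ ∃ m, (ad i, .send m) ∈ e.2.1.lab.2

/-- The action `a` is performed on node `i`. -/
def PerformEvent (ad : Fin 3 → IP) (i : Fin 3) (a : Act IP Data) : Event IP Data := fun e =>
  (ad i, a) ∈ e.2.1.lab.2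

theorem keeps_of_eq {g g' : LineState IP Data} (h : ∀ i, (g' i).1 = (g i).1 ∨
    Keeps (J i) (g' i).1.1) :
    (∀ i, Keeps (J i) (g i).1.1) → ∀ i, Keeps (J i) (g' i).1.1 := by
  intro hg i
  rcases h i with h | h
  · rw [h]
    exact hg i
  · exact h

theorem LineStepKeeps.local {g : LineState IP Data} {i : Fin 3} {om oq s q o l}
    (hm : Moves SeqStep (g i).1 om s) (hq : Moves SeqStep (g i).2 oq q)
    (hJ : s = (g i).1 ∨ Keeps (J i) s.1) (ho : ParRule (decorate om) (decorate oq) o)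
    (hn : NodeRule (ad i) (R i) (some o) l (R i))
    (hl : (∃ t, l = (.tau, t)) ∨ ∃ ip d t, l = (.deliver ip d, t)) :
    LineStepKeeps ad R J g
      ⟨Function.update (fun _ => none) i om, Function.update (fun _ => none) i oq, l⟩
      (Function.update g i (s, q)) := by
  refine ⟨.local (by
    refine ⟨?_, ?_, some o, ho, hn⟩
    · simpa using hm
    · simpa using hq) (fun j hj => by simp [hj]) hl, keeps_of_eq fun j => ?_⟩
  by_cases hj : j = i
  · subst hj
    simpa using hJ
  · simp [hj]

theorem Conf.At.update {K K' : Conf IP Data} {g : LineState IP Data} (h : K.At g) {i : Fin 3}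
    {s q} (hs : (K' i).1 s) (hq : QueueAt (K' i).2 q) (hK : ∀ j, j ≠ i → K' j = K j) :
    K'.At (Function.update g i (s, q)) := by
  intro j
  by_cases hj : j = i
  · subst hj
    simpa using ⟨hs, hq⟩
  · simpa [hj, hK j hj] using h j

/-- Internal steps of a main process need no partner, so each one lifts to the network while the
queue and the other nodes stand still. -/
theorem trace_of_seqTau {s s' : SState IP Data} {i : Fin 3} (h : SeqTau (J i) s s')
    (g : LineState IP Data) (hg : (g i).1 = s) :
    ∃ p, Trace (LineStepKeeps ad R J) g p (Function.update g i (s', (g i).2)) := by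
  induction h with
  | refl => exact ⟨[], by rw [← hg]; simpa using Trace.nil⟩
  | @tail s₁ s₂ _ hs ih =>
    obtain ⟨p, hp⟩ := ih
    have h2 : LineStepKeeps ad R J (Function.update g i (s₁, (g i).2)) _
        (Function.update (Function.update g i (s₁, (g i).2)) i (s₂, (g i).2)) :=
      LineStepKeeps.local (om := some .tau) (oq := none) (by simpa [Moves] using hs.1) (by simp
        [Moves])
        (.inr hs.2) (.left (by simp)) .tau (.inl ⟨_, rfl⟩)
    rw [Function.update_idem] at h2
    exact ⟨_, hp.append (.single h2)⟩

/-- The main process of node `i` performs internal steps. -/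
theorem Leads.seqTau {K K' : Conf IP Data} (i : Fin 3)
    (h : ∀ s, (K i).1 s → ∃ s', SeqTau (J i) s s' ∧ (K' i).1 s') (hK : (K' i).2 = (K i).2)
    (hK' : ∀ j, j ≠ i → K' j = K j) : Leads ad R J [] K K' := by
  intro g hg
  obtain ⟨s', hs, hs'⟩ := h _ (hg i).1
  obtain ⟨p, hp⟩ := trace_of_seqTau (ad := ad) (R := R) hs g rfl
  exact ⟨p, _, hp, hg.update hs' (hK ▸ (hg i).2) hK', by simp⟩

/-- The main process of node `i` performs an internal step. -/
theorem Leads.tau {K K' : Conf IP Data} (i : Fin 3)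
    (h : ∀ s, (K i).1 s → ∃ s', SeqStep s .tau s' ∧ Keeps (J i) s'.1 ∧ (K' i).1 s')
    (hK : (K' i).2 = (K i).2) (hK' : ∀ j, j ≠ i → K' j = K j) :
    Leads ad R J [fun e => (K i).1 (e.1 i).1 ∧ (K' i).1 (e.2.2 i).1] K K' := by
  intro g hg
  obtain ⟨s', hs, hJ, hs'⟩ := h _ (hg i).1
  exact ⟨_, _, .single (LineStepKeeps.local (om := some .tau) (oq := none) hs rfl (.inr hJ)
    (.left (by simp)) .tau (.inl ⟨_, rfl⟩)), hg.update hs' (hK ▸ (hg i).2) hK',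
    by simpa using ⟨(hg i).1, hs'⟩⟩

/-- The main process of node `i` delivers a data packet. -/
theorem Leads.deliver {K K' : Conf IP Data} (i : Fin 3) {d : Data}
    (h : ∀ s, (K i).1 s → ∃ s', SeqStep s (.deliver d) s' ∧ Keeps (J i) s'.1 ∧ (K' i).1 s')
    (hK : (K' i).2 = (K i).2) (hK' : ∀ j, j ≠ i → K' j = K j) : Leads ad R J [] K K' := by
  intro g hg
  obtain ⟨s', hs, hJ, hs'⟩ := h _ (hg i).1
  exact ⟨_, _, .single (LineStepKeeps.local (om := some (.deliver d)) (oq := none) hs rfl (.inr hJ)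
    (.left (by simp)) .deliver (.inr ⟨_, _, _, rfl⟩)), hg.update hs' (hK ▸ (hg i).2) hK', by simp⟩

/-- The main process of node `i` takes a message from its queue. -/
theorem Leads.receive {K K' : Conf IP Data} (i : Fin 3) {m : Msg IP Data}
    (h : ∀ s, (K i).1 s → ∃ s', SeqStep s (.receive m) s' ∧ Keeps (J i) s'.1 ∧ (K' i).1 s')
    (hK : (K i).2 = m :: (K' i).2) (hK' : ∀ j, j ≠ i → K' j = K j) :
    Leads ad R J [SyncEvent ad i] K K' := by
  intro g hg
  obtain ⟨s', hs, hJ, hs'⟩ := h _ (hg i).1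
  obtain ⟨q₁, q₂, hq₁, hq₂, hq⟩ := QueueAt.send (hK ▸ (hg i).2)
  -- The queue passes its guard alone; only then does its send action synchronise with the main
  -- process.
  have h1 : LineStepKeeps ad R J g _ (Function.update g i ((g i).1, q₁)) :=
    LineStepKeeps.local (om := none) (oq := some .tau) rfl hq₁ (.inl rfl) (.right (by simp)) .tau
      (.inl ⟨_, rfl⟩)
  have h2 : LineStepKeeps ad R J (Function.update g i ((g i).1, q₁)) _
      (Function.update (Function.update g i ((g i).1, q₁)) i (s', q₂)) :=
    LineStepKeeps.local (om := some (.receive m)) (oq := some (.send m)) (by simpa [Moves] using hs)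
      (by simpa [Moves] using hq₂) (.inr hJ) .sync .tau (.inl ⟨_, rfl⟩)
  rw [Function.update_idem] at h2
  exact ⟨_, _, .cons h1 (.single h2), hg.update hs' hq hK', by simp [SyncEvent]⟩

/-- A data packet is injected at node `i`. -/
theorem Leads.newpkt {K K' : Conf IP Data} (i : Fin 3) (d : Data) (dip : IP)
    (hK : K' i = ((K i).1, (K i).2 ++ [.newpkt d dip])) (hK' : ∀ j, j ≠ i → K' j = K j) :
    Leads ad R J [] K K' := by
  intro g hg
  obtain ⟨q, hq, hq'⟩ := (hg i).2.receive (.newpkt d dip)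
  obtain ⟨mv, h⟩ := LineStep.newpkt (ad := ad) (R := R) (g := g) (g' := Function.update g i ((g
    i).1, q)) (i := i)
    (by simp) (by simpa using hq) (fun j hj => by simp [hj])
  refine ⟨_, _, .single ⟨h, keeps_of_eq fun j => .inl ?_⟩, hg.update ?_ ?_ hK', by simp⟩
  · by_cases hj : j = i
    · subst hj
      simp
    · simp [hj]
  · simpa [hK] using (hg i).1
  · simpa [hK] using hq'

/-- The main process of node `i` sends a message to the nodes in `D`. -/
theorem Leads.cast {K K' : Conf IP Data} (i : Fin 3) {a : Act IP Data} {D : Set IP}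
    {m : Msg IP Data} (ha : ∀ m, a ≠ .receive m)
    (hn : NodeRule (ad i) (R i) (some (a, [a])) (.cast D m, [(ad i, a)]) (R i))
    (h : ∀ s, (K i).1 s → ∃ s', SeqStep s a s' ∧ Keeps (J i) s'.1 ∧ (K' i).1 s')
    (hK : (K' i).2 = (K i).2)
    (hK' : ∀ j, j ≠ i → ad j ∈ D ∧ K' j = ((K j).1, (K j).2 ++ [m]) ∨ ad j ∉ D ∧ K' j = K j) :
    Leads ad R J [PerformEvent ad i a] K K' := by
  intro g hg
  obtain ⟨s', hs, hJ, hs'⟩ := h _ (hg i).1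
  -- Successors of all queues are chosen; `g'` uses only those of the nodes in `D`.
  choose q hq hq' using fun j => (hg j).2.receive m
  classical
  let g' : LineState IP Data := fun j =>
    if j = i then (s', (g i).2) else if ad j ∈ D then ((g j).1, q j) else g j
  have hi : g' i = (s', (g i).2) := by simp [g']
  have hne : ∀ j, j ≠ i → g' j = if ad j ∈ D then ((g j).1, q j) else g j := by
    intro j hj
    simp [g', hj]
  obtain ⟨mv, t, h1, h2, h3⟩ := LineStep.cast (ad := ad) (R := R) (g := g) (g' := g') (i := i)
    (by rw [hi]; exact hs) (by rw [hi]) ha hn (by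
      intro j hj
      rw [hne j hj]
      by_cases hD : ad j ∈ D
      · simpa [hD] using hq j
      · simp [hD])
  refine ⟨_, g', .single ⟨h1, keeps_of_eq fun j => ?_⟩, fun j => ?_, by simpa [PerformEvent, h2]
    using h3⟩
  · by_cases hj : j = i
    · subst hj
      rw [hi]
      exact .inr hJ
    · rw [hne j hj]
      split_ifs <;> exact .inl rfl
  · by_cases hj : j = i
    · subst hj
      rw [hi, hK]
      exact ⟨hs', (hg j).2⟩
    · rw [hne j hj]
      rcases hK' j hj with ⟨hD, hKj⟩ | ⟨hD, hKj⟩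
      · rw [hKj, if_pos hD]
        exact ⟨(hg j).1, hq' j⟩
      · rw [hKj, if_neg hD]
        exact hg j

end Conf

/-! ### Behaviour of the main process -/

section Routines

variable {IP Data : Type}

/-- The data maintained by a node. -/
structure NodeData (IP Data : Type) where
  ip : IP
  sn : ℕ
  rt : RT IP
  rreqs : Set (IP × ℕ)
  store : Store IP Data

/-- The valuation `ξ` carries the data `n`. -/
def NodeData.In (n : NodeData IP Data) (ξ : Val IP Data) : Prop :=
  ξ .ip = some n.ip ∧ ξ .sn = some n.sn ∧ ξ .rt = some n.rt ∧ ξ .rreqs = some n.rreqs ∧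
    ξ .store = some n.store

/-- The main process is about to perform the routine `X`, with data `n` and message fields as
described by `φ`. -/
def CallAt (X : PName) (n : NodeData IP Data) (φ : Val IP Data → Prop) (s : SState IP Data) :
    Prop :=
  ∃ ξ, s = (ξ, .callVars X) ∧ n.In ξ ∧ φ ξ

/-- The main process is about to perform the basic routine with data `n`. -/
def MainAt (n : NodeData IP Data) : SState IP Data → Prop := CallAt .aodv n fun _ => True

theorem keeps_of_eq_some {J : Set (RT IP)} {ξ : Val IP Data} {rt : RT IP} (h : ξ .rt = some rt)
    (hJ : rt ∈ J) : Keeps J ξ := by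
  intro rt' h'
  rw [h] at h'
  exact Option.some.inj h' ▸ hJ

theorem SeqTau.cons {J : Set (RT IP)} {s s₁ s₂ : SState IP Data} {rt : RT IP}
    (h : SeqStep s .tau s₁) (hs : s₁.1 .rt = some rt) (hJ : rt ∈ J) (h' : SeqTau J s₁ s₂) :
    SeqTau J s s₂ :=
  .head ⟨h, keeps_of_eq_some hs hJ⟩ h'

theorem SeqTau.last {J : Set (RT IP)} {s s₁ : SState IP Data} {rt : RT IP}
    (h : SeqStep s .tau s₁) (hs : s₁.1 .rt = some rt) (hJ : rt ∈ J) : SeqTau J s s₁ :=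
  .cons h hs hJ .refl

/-- The fields of a route request. -/
def RreqFields (hops rreqid : ℕ) (dip : IP) (dsn : ℕ) (dsk : SqnKnown) (oip : IP) (osn : ℕ)
    (sip : IP) (ξ : Val IP Data) : Prop :=
  ξ .hops = some hops ∧ ξ .rreqid = some rreqid ∧ ξ .dip = some dip ∧ ξ .dsn = some dsn ∧
    ξ .dsk = some dsk ∧ ξ .oip = some oip ∧ ξ .osn = some osn ∧ ξ .sip = some sip

/-- The fields of a route reply. -/
def RrepFields (hops : ℕ) (dip : IP) (dsn : ℕ) (oip sip : IP) (ξ : Val IP Data) : Prop :=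
  ξ .hops = some hops ∧ ξ .dip = some dip ∧ ξ .dsn = some dsn ∧ ξ .oip = some oip ∧
    ξ .sip = some sip

/-- `P'` is reached from `P` by receiving `m` and then performing internal steps. -/
def Receives (J : Set (RT IP)) (m : Msg IP Data) (P P' : SState IP Data → Prop) : Prop :=
  ∀ s, P s → ∃ s₁, SeqStep s (.receive m) s₁ ∧ Keeps J s₁.1 ∧ ∃ s₂, SeqTau J s₁ s₂ ∧ P' s₂

/-- `P'` is reached from `P` by internal steps. -/
def Proceeds (J : Set (RT IP)) (P P' : SState IP Data → Prop) : Prop :=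
  ∀ s, P s → ∃ s', SeqTau J s s' ∧ P' s'

/-- `P'` is reached from `P` by the action `a`. -/
def Acts (J : Set (RT IP)) (a : Act IP Data) (P P' : SState IP Data → Prop) : Prop :=
  ∀ s, P s → ∃ s', SeqStep s a s' ∧ Keeps J s'.1 ∧ P' s'

variable {J : Set (RT IP)} {n : NodeData IP Data}

/-- A call erases all variables except the parameters. After it the message fields are undefined,
and the guard binds them (valuation `ζ`) by matching against `msg`. The lemmas for the other kinds
of messages work in the same way. -/
theorem receives_newpkt (hJ : n.rt ∈ J) (data : Data) (dip : IP) :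
    Receives J (.newpkt data dip) (MainAt n)
      (CallAt .newpkt n fun ξ => ξ .data = some data ∧ ξ .dip = some dip) := by
  rintro _ ⟨ξ, rfl, ⟨h1, h2, h3, h4, h5⟩, -⟩
  let ζ : Val IP Data
    | .data => some data
    | .dip => some dip
    | v => Function.update (bindArgs .aodv (fun v ξ => ξ v) ξ) .msg (some (.newpkt data dip)) v
  have e1 : ζ .ip = some n.ip := by simp [ζ, bindArgs, params, h1]
  have e2 : ζ .sn = some n.sn := by simp [ζ, bindArgs, params, h2]
  have e3 : ζ .rt = some n.rt := by simp [ζ, bindArgs, params, h3]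
  have e4 : ζ .rreqs = some n.rreqs := by simp [ζ, bindArgs, params, h4]
  have e5 : ζ .store = some n.store := by simp [ζ, bindArgs, params, h5]
  refine ⟨_, .call ?_ (.choiceLeft (.receive _)), keeps_of_eq_some (by simpa [bindArgs, params]
    using h3) hJ, (ζ, _),
    .last (.choiceLeft (.guard ?_)) e3 hJ, ζ, rfl, ⟨e1, e2, e3, e4, e5⟩, rfl, rfl⟩
  · simp [params, *]
  · refine ⟨fun v => ?_, fun v => ?_, fun v => ?_, ?_⟩
    · cases v <;> simp [ζ, bindArgs, params]
    · cases v <;> simp [ζ]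
    · cases v <;> simp [ζ]
    · exact ⟨_, _, rfl, rfl, by simp [ζ]⟩

theorem receives_pkt (hJ : n.rt ∈ J) (data : Data) (dip oip : IP) :
    Receives J (.pkt data dip oip) (MainAt n) (CallAt .pkt n fun ξ =>
      ξ .data = some data ∧ ξ .dip = some dip ∧ ξ .oip = some oip) := by
  rintro _ ⟨ξ, rfl, ⟨h1, h2, h3, h4, h5⟩, -⟩
  let ζ : Val IP Data
    | .data => some data
    | .dip => some dip
    | .oip => some oip
    | v => Function.update (bindArgs .aodv (fun v ξ => ξ v) ξ) .msg (some (.pkt data dip oip)) v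
  have e1 : ζ .ip = some n.ip := by simp [ζ, bindArgs, params, h1]
  have e2 : ζ .sn = some n.sn := by simp [ζ, bindArgs, params, h2]
  have e3 : ζ .rt = some n.rt := by simp [ζ, bindArgs, params, h3]
  have e4 : ζ .rreqs = some n.rreqs := by simp [ζ, bindArgs, params, h4]
  have e5 : ζ .store = some n.store := by simp [ζ, bindArgs, params, h5]
  refine ⟨_, .call ?_ (.choiceLeft (.receive _)), keeps_of_eq_some (by simpa [bindArgs, params]
    using h3) hJ, (ζ, _),
    .last (.choiceRight (.choiceLeft (.guard ?_))) e3 hJ, ζ, rfl, ⟨e1, e2, e3, e4, e5⟩, rfl, rfl,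
      rfl⟩
  · simp [params, *]
  · refine ⟨fun v => ?_, fun v => ?_, fun v => ?_, ?_⟩
    · cases v <;> simp [ζ, bindArgs, params]
    · cases v <;> simp [ζ]
    · cases v <;> simp [ζ]
    · exact ⟨_, _, _, rfl, rfl, rfl, by simp [ζ]⟩

/-- Decoding is followed by an entry for the previous hop. The table therefore may change even if
the request itself is afterwards ignored, and both tables have to lie in `J`. -/
theorem receives_rreq {hops rreqid : ℕ} {dip : IP} {dsn : ℕ} {dsk : SqnKnown} {oip : IP} {osn : ℕ}
    {sip : IP} {rt : RT IP} (hJ : n.rt ∈ J) (hJ' : rt ∈ J)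
    (hrt : update n.rt sip ⟨0, .unk, .val, 1, sip, ∅⟩ = some rt) :
    Receives J (.rreq hops rreqid dip dsn dsk oip osn sip) (MainAt n)
      (CallAt .rreq { n with rt := rt } (RreqFields hops rreqid dip dsn dsk oip osn sip)) := by
  rintro _ ⟨ξ, rfl, ⟨h1, h2, h3, h4, h5⟩, -⟩
  let ζ : Val IP Data
    | .hops => some hops
    | .rreqid => some rreqid
    | .dip => some dip
    | .dsn => some dsn
    | .dsk => some dsk
    | .oip => some oip
    | .osn => some osn
    | .sip => some sip
    | v => Function.update (bindArgs .aodv (fun v ξ => ξ v) ξ) .msg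
        (some (.rreq hops rreqid dip dsn dsk oip osn sip)) v
  have e1 : ζ .ip = some n.ip := by simp [ζ, bindArgs, params, h1]
  have e2 : ζ .sn = some n.sn := by simp [ζ, bindArgs, params, h2]
  have e3 : ζ .rt = some n.rt := by simp [ζ, bindArgs, params, h3]
  have e4 : ζ .rreqs = some n.rreqs := by simp [ζ, bindArgs, params, h4]
  have e5 : ζ .store = some n.store := by simp [ζ, bindArgs, params, h5]
  refine ⟨_, .call ?_ (.choiceLeft (.receive _)), keeps_of_eq_some (by simpa [bindArgs, params]
    using h3) hJ, _,
    .cons (s₁ := (ζ, _)) (.choiceRight (.choiceRight (.choiceLeft (.guard ?_)))) e3 hJ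
      (.last (.assign (x := rt) ?_) (by simp) hJ'), _, rfl, ?_, ?_⟩
  · simp [params, *]
  · refine ⟨fun v => ?_, fun v => ?_, fun v => ?_, ?_⟩
    · cases v <;> simp [ζ, bindArgs, params]
    · cases v <;> simp [ζ]
    · cases v <;> simp [ζ]
    · exact ⟨_, _, _, _, _, _, _, _, rfl, rfl, rfl, rfl, rfl, rfl, rfl, rfl, by simp [ζ]⟩
  · rw [e3]
    exact hrt
  · simp [NodeData.In, *]
  · simp [RreqFields, ζ]

theorem receives_rrep {hops : ℕ} {dip : IP} {dsn : ℕ} {oip sip : IP} {rt : RT IP} (hJ : n.rt ∈ J)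
    (hJ' : rt ∈ J) (hrt : update n.rt sip ⟨0, .unk, .val, 1, sip, ∅⟩ = some rt) :
    Receives J (.rrep hops dip dsn oip sip) (MainAt n)
      (CallAt .rrep { n with rt := rt } (RrepFields hops dip dsn oip sip)) := by
  rintro _ ⟨ξ, rfl, ⟨h1, h2, h3, h4, h5⟩, -⟩
  let ζ : Val IP Data
    | .hops => some hops
    | .dip => some dip
    | .dsn => some dsn
    | .oip => some oip
    | .sip => some sip
    | v => Function.update (bindArgs .aodv (fun v ξ => ξ v) ξ) .msg
        (some (.rrep hops dip dsn oip sip)) v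
  have e1 : ζ .ip = some n.ip := by simp [ζ, bindArgs, params, h1]
  have e2 : ζ .sn = some n.sn := by simp [ζ, bindArgs, params, h2]
  have e3 : ζ .rt = some n.rt := by simp [ζ, bindArgs, params, h3]
  have e4 : ζ .rreqs = some n.rreqs := by simp [ζ, bindArgs, params, h4]
  have e5 : ζ .store = some n.store := by simp [ζ, bindArgs, params, h5]
  refine ⟨_, .call ?_ (.choiceLeft (.receive _)), keeps_of_eq_some (by simpa [bindArgs, params]
    using h3) hJ, _,
    .cons (s₁ := (ζ, _)) (.choiceRight (.choiceRight (.choiceRight (.choiceLeft (.guard ?_))))) e3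
      hJ
      (.last (.assign (x := rt) ?_) (by simp) hJ'), _, rfl, ?_, ?_⟩
  · simp [params, *]
  · refine ⟨fun v => ?_, fun v => ?_, fun v => ?_, ?_⟩
    · cases v <;> simp [ζ, bindArgs, params]
    · cases v <;> simp [ζ]
    · cases v <;> simp [ζ]
    · exact ⟨_, _, _, _, _, rfl, rfl, rfl, rfl, rfl, by simp [ζ]⟩
  · rw [e3]
    exact hrt
  · simp [NodeData.In, *]
  · simp [RrepFields, ζ]

/-- A new data packet for another node is stored. -/
theorem newpkt_store {data : Data} {dip : IP} (hJ : n.rt ∈ J) (hd : dip ≠ n.ip) :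
    Proceeds J (CallAt .newpkt n fun ξ => ξ .data = some data ∧ ξ .dip = some dip)
      (MainAt { n with store := add data dip n.store }) := by
  rintro _ ⟨ξ, rfl, ⟨h1, h2, h3, h4, h5⟩, h6, h7⟩
  refine ⟨_, .cons (.call ?_ (.choiceRight (.guard (.refl ?_ ?_)))) ?_ hJ
    (.last (.assign (x := add data dip n.store) ?_) ?_ hJ), _, rfl, ?_, trivial⟩
  · simp [params, *]
  all_goals simp [NodeData.In, bindArgs, params, *]

/-- A data packet for the node itself is about to be delivered. -/
def DeliversAt (n : NodeData IP Data) (data : Data) (s : SState IP Data) : Prop :=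
  ∃ ξ, s = (ξ, .deliver (fun ξ => ξ .data) (.callVars .aodv)) ∧ n.In ξ ∧ ξ .data = some data

theorem DeliversAt.acts {data : Data} (hJ : n.rt ∈ J) :
    Acts J (.deliver data) (DeliversAt n data) (MainAt n) := by
  rintro _ ⟨ξ, rfl, h, hd⟩
  exact ⟨_, .deliver hd, keeps_of_eq_some h.2.2.1 hJ, ξ, rfl, h, trivial⟩

theorem newpkt_deliver {data : Data} (hJ : n.rt ∈ J) :
    Proceeds J (CallAt .newpkt n fun ξ => ξ .data = some data ∧ ξ .dip = some n.ip)
      (DeliversAt n data) := by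
  rintro _ ⟨ξ, rfl, ⟨h1, h2, h3, h4, h5⟩, h6, h7⟩
  refine ⟨_, .last (.call ?_ (.choiceLeft (.guard (.refl ?_ ?_)))) ?_ hJ, _, rfl, ?_, ?_⟩
  · simp [params, *]
  all_goals simp [NodeData.In, bindArgs, params, *]

theorem pkt_deliver {data : Data} {oip : IP} (hJ : n.rt ∈ J) :
    Proceeds J (CallAt .pkt n fun ξ =>
      ξ .data = some data ∧ ξ .dip = some n.ip ∧ ξ .oip = some oip) (DeliversAt n data) := by
  rintro _ ⟨ξ, rfl, ⟨h1, h2, h3, h4, h5⟩, h6, h7, h8⟩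
  refine ⟨_, .last (.call ?_ (.choiceLeft (.guard (.refl ?_ ?_)))) ?_ hJ, _, rfl, ?_, ?_⟩
  · simp [params, *]
  all_goals simp [NodeData.In, bindArgs, params, *]

/-- The node is about to broadcast `m`. -/
def BcastAt (n : NodeData IP Data) (m : Msg IP Data) (s : SState IP Data) : Prop :=
  ∃ ξ ms, s = (ξ, .bcast ms (.callVars .aodv)) ∧ n.In ξ ∧ ms ξ = some m

theorem BcastAt.acts {m : Msg IP Data} (hJ : n.rt ∈ J) :
    Acts J (.bcast m) (BcastAt n m) (MainAt n) := by
  rintro _ ⟨ξ, ms, rfl, h, hm⟩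
  exact ⟨_, .bcast hm, keeps_of_eq_some h.2.2.1 hJ, ξ, rfl, h, trivial⟩

/-- The node is about to unicast `m` to `dest`, and continues with the basic routine. -/
def UcastAt (n : NodeData IP Data) (dest : IP) (m : Msg IP Data) (s : SState IP Data) : Prop :=
  ∃ ξ e ms q, s = (ξ, .ucast e ms (.callVars .aodv) q) ∧ n.In ξ ∧ e ξ = some dest ∧ ms ξ = some m

theorem UcastAt.acts {dest : IP} {m : Msg IP Data} (hJ : n.rt ∈ J) :
    Acts J (.ucast dest m) (UcastAt n dest m) (MainAt n) := by
  rintro _ ⟨ξ, e, ms, q, rfl, h, hd, hm⟩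
  exact ⟨_, .ucast hd hm, keeps_of_eq_some h.2.2.1 hJ, ξ, rfl, h, trivial⟩

/-- A route request is initiated. -/
theorem initiate_rreq {dip : IP} {id : ℕ} (hJ : n.rt ∈ J) (hq : selFlag n.store dip = some .req)
    (hv : dip ∉ vD n.rt) (hid : nrreqid n.rreqs n.ip = some id) :
    Proceeds J (MainAt n) (BcastAt
      { n with
        sn := inc n.sn
        rreqs := n.rreqs ∪ {(n.ip, id)}
        store := unsetRRF n.store dip }
      (.rreq 0 id dip (sqn n.rt dip) (sqnf n.rt dip) n.ip (inc n.sn) n.ip)) := by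
  rintro _ ⟨ξ, rfl, ⟨h1, h2, h3, h4, h5⟩, -⟩
  have hqD : dip ∈ qD n.store := by
    cases hs : n.store dip with
    | none => simp [selFlag, hs] at hq
    | some x => exact ⟨x, hs⟩
  -- `dip` is not a parameter of the basic routine, so it is unbound here and the guard may choose
  -- it.
  refine ⟨_, .cons (.call ?_ (.choiceRight (.choiceRight (.guard
      (ζ := Function.update (bindArgs .aodv (fun v ξ => ξ v) ξ) .dip (some dip)) ?_)))) ?_ hJ <|
    .cons (.assign (x := unsetRRF n.store dip) ?_) ?_ hJ <|
    .cons (.assign (x := inc n.sn) ?_) ?_ hJ <|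
    .cons (.assign (x := id) ?_) ?_ hJ <|
    .last (.assign (x := n.rreqs ∪ {(n.ip, id)}) ?_) ?_ hJ, _, _, rfl, ?_, ?_⟩
  · simp [params, *]
  · refine ⟨fun v => ?_, fun v => ?_, fun v => ?_, ?_⟩
    · cases v <;> simp [bindArgs, params]
    · cases v <;> simp [bindArgs, params]
    · cases v <;> simp [bindArgs, params, *]
    · exact ⟨dip, n.store, n.rt, by simp, by simp [bindArgs, params, *], by simp [bindArgs, params,
        *],
        ⟨hqD, hv⟩, hq⟩
  all_goals simp [NodeData.In, bindArgs, params, *]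

/-- A queued data packet is about to be sent. -/
def SendsPktAt (n : NodeData IP Data) (dest : IP) (data : Data) (dip : IP) (st' : Store IP Data)
    (s : SState IP Data) : Prop :=
  ∃ ξ e ms q, s = (ξ, .ucast e ms (.assign .store (fun ξ => do drop (← ξ .dip) (← ξ .store)) <|
    .callVars .aodv) q) ∧ n.In ξ ∧ e ξ = some dest ∧ ms ξ = some (.pkt data dip n.ip) ∧
    ξ .dip = some dip ∧ drop dip n.store = some st'

/-- A queued data packet has been sent, and is to be removed from the store. -/
def DropsPktAt (n : NodeData IP Data) (st' : Store IP Data) (s : SState IP Data) : Prop :=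
  ∃ ξ e, s = (ξ, .assign .store e (.callVars .aodv)) ∧ n.In ξ ∧ e ξ = some st'

theorem SendsPktAt.acts {dest : IP} {data : Data} {dip : IP} {st' : Store IP Data} (hJ : n.rt ∈ J) :
    Acts J (.ucast dest (.pkt data dip n.ip)) (SendsPktAt n dest data dip st')
      (DropsPktAt n st') := by
  rintro _ ⟨ξ, e, ms, q, rfl, h, hd, hm, h6, h7⟩
  exact ⟨_, .ucast hd hm, keeps_of_eq_some h.2.2.1 hJ, ξ, _, rfl, h, by simp [h6, h.2.2.2.2, h7]⟩

theorem dropsPkt {st' : Store IP Data} (hJ : n.rt ∈ J) :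
    Proceeds J (DropsPktAt n st') (MainAt { n with store := st' }) := by
  rintro _ ⟨ξ, e, rfl, ⟨h1, h2, h3, h4, h5⟩, he⟩
  refine ⟨_, .last (.assign (x := st') he) ?_ hJ, _, rfl, ?_, trivial⟩
  all_goals simp [NodeData.In, *]

/-- This stops just before the unicast: the packet leaves the store only after a successful
transmission, in `dropsPkt`. -/
theorem initiate_pkt {dip dest : IP} {data : Data} {st' : Store IP Data} (hJ : n.rt ∈ J)
    (hv : dip ∈ vD n.rt) (hn : nhop n.rt dip = some dest)
    (hd : (selQueue n.store dip).head? = some data) (hs : drop dip n.store = some st') :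
    Proceeds J (MainAt n) (SendsPktAt n dest data dip st') := by
  rintro _ ⟨ξ, rfl, ⟨h1, h2, h3, h4, h5⟩, -⟩
  have hqD : dip ∈ qD n.store := by
    cases hs : n.store dip with
    | none => simp [selQueue, hs] at hd
    | some x => exact ⟨x, hs⟩
  refine ⟨_, .cons (.call ?_ (.choiceRight (.choiceLeft (.guard
      (ζ := Function.update (bindArgs .aodv (fun v ξ => ξ v) ξ) .dip (some dip)) ?_)))) ?_ hJ <|
    .last (.assign (x := data) ?_) ?_ hJ, _, _, _, _, rfl, ?_, ?_, ?_, ?_, hs⟩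
  · simp [params, *]
  · refine ⟨fun v => ?_, fun v => ?_, fun v => ?_, ?_⟩
    · cases v <;> simp [bindArgs, params]
    · cases v <;> simp [bindArgs, params]
    · cases v <;> simp [bindArgs, params, *]
    · exact ⟨dip, n.store, n.rt, by simp, by simp [bindArgs, params, *], by simp [bindArgs, params,
        *],
        hqD, hv⟩
  all_goals simp [NodeData.In, nhopTo, bindArgs, params, *]

section Rreq

variable {hops rreqid : ℕ} {dip : IP} {dsn : ℕ} {dsk : SqnKnown} {oip : IP} {osn : ℕ} {sip : IP}
  {rt : RT IP}

/-- A route request that was seen before is ignored. -/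
theorem rreq_seen (hJ : n.rt ∈ J) (h : (oip, rreqid) ∈ n.rreqs) :
    Proceeds J (CallAt .rreq n (RreqFields hops rreqid dip dsn dsk oip osn sip)) (MainAt n) := by
  rintro _ ⟨ξ, rfl, ⟨h1, h2, h3, h4, h5⟩, f1, f2, f3, f4, f5, f6, f7, f8⟩
  refine ⟨_, .last (.call ?_ (.choiceLeft (.guard (.refl ?_ ?_)))) ?_ hJ, _, rfl, ?_, trivial⟩
  · simp [params, *]
  all_goals simp [NodeData.In, bindArgs, params, *]

/-- The destination of a route request answers. -/
theorem rreq_destination {dest : IP} (hJ : n.rt ∈ J) (hJ' : rt ∈ J) (h : (oip, rreqid) ∉ n.rreqs)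
    (hrt : update n.rt oip ⟨osn, .kno, .val, hops + 1, sip, ∅⟩ = some rt)
    (hn : nhop rt oip = some dest) :
    Proceeds J (CallAt .rreq n (RreqFields hops rreqid n.ip dsn dsk oip osn sip))
      (UcastAt
        { n with
          sn := max n.sn dsn
          rt := rt
          rreqs := n.rreqs ∪ {(oip, rreqid)} }
        dest (.rrep 0 n.ip (max n.sn dsn) oip n.ip)) := by
  rintro _ ⟨ξ, rfl, ⟨h1, h2, h3, h4, h5⟩, f1, f2, f3, f4, f5, f6, f7, f8⟩
  refine ⟨_, .cons (.call ?_ (.choiceRight (.guard (.refl ?_ ?_)))) ?_ hJ <|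
    .cons (.assign (x := rt) ?_) ?_ hJ' <|
    .cons (.assign (x := n.rreqs ∪ {(oip, rreqid)}) ?_) ?_ hJ' <|
    .cons (.choiceLeft (.guard (.refl ?_ ?_))) ?_ hJ' <|
    -- The own number is raised at most to the requested one and is not incremented. This is the
    -- source of the lost reply.
    .last (.assign (x := max n.sn dsn) ?_) ?_ hJ', _, _, _, _, rfl, ?_, ?_, ?_⟩
  · simp [params, *]
  all_goals simp [NodeData.In, nhopTo, bindArgs, params, *]

/-- A route request is forwarded. -/
theorem rreq_forward (hJ : n.rt ∈ J) (hJ' : rt ∈ J) (h : (oip, rreqid) ∉ n.rreqs)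
    (hrt : update n.rt oip ⟨osn, .kno, .val, hops + 1, sip, ∅⟩ = some rt)
    (hd : dip ≠ n.ip) (hv : dip ∉ vD rt) :
    Proceeds J (CallAt .rreq n (RreqFields hops rreqid dip dsn dsk oip osn sip))
      (BcastAt
        { n with
          rt := rt
          rreqs := n.rreqs ∪ {(oip, rreqid)} }
        (.rreq (hops + 1) rreqid dip (max (sqn rt dip) dsn) dsk oip osn n.ip)) := by
  rintro _ ⟨ξ, rfl, ⟨h1, h2, h3, h4, h5⟩, f1, f2, f3, f4, f5, f6, f7, f8⟩
  refine ⟨_, .cons (.call ?_ (.choiceRight (.guard (.refl ?_ ?_)))) ?_ hJ <|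
    .cons (.assign (x := rt) ?_) ?_ hJ' <|
    .cons (.assign (x := n.rreqs ∪ {(oip, rreqid)}) ?_) ?_ hJ' <|
    .cons (.choiceRight (.guard (.refl ?_ ?_))) ?_ hJ' <|
    .last (.choiceRight (.guard (.refl ?_ ?_))) ?_ hJ', _, _, rfl, ?_, ?_⟩
  · simp [params, *]
  all_goals simp [NodeData.In, bindArgs, params, *]

end Rreq

section Rrep

variable {hops : ℕ} {dip : IP} {dsn : ℕ} {oip sip : IP} {rt : RT IP}

/-- A route reply that carries no new information is ignored. -/
theorem rrep_ignore (hJ : n.rt ∈ J)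
    (hrt : update n.rt dip ⟨dsn, .kno, .val, hops + 1, sip, ∅⟩ = some n.rt) :
    Acts J .tau (CallAt .rrep n (RrepFields hops dip dsn oip sip)) (MainAt n) := by
  rintro _ ⟨ξ, rfl, ⟨h1, h2, h3, h4, h5⟩, f1, f2, f3, f4, f5⟩
  -- A single guard step returns to the basic routine, so the drop is one transition whose two ends
  -- can be observed.
  refine ⟨_, .call ?_ (.choiceRight (.guard (.refl ?_ ?_))), keeps_of_eq_some ?_ hJ, _, rfl, ?_,
    trivial⟩
  · simp [params, *]
  all_goals simp [NodeData.In, rrepUpdate, bindArgs, params, *]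

/-- A route reply reaches the originator of the request. -/
theorem rrep_originator (hJ : n.rt ∈ J) (hJ' : rt ∈ J)
    (hrt : update n.rt dip ⟨dsn, .kno, .val, hops + 1, sip, ∅⟩ = some rt) (hne : n.rt ≠ rt) :
    Proceeds J (CallAt .rrep n (RrepFields hops dip dsn n.ip sip)) (MainAt { n with rt := rt }) := by
  rintro _ ⟨ξ, rfl, ⟨h1, h2, h3, h4, h5⟩, f1, f2, f3, f4, f5⟩
  refine ⟨_, .cons (.call ?_ (.choiceLeft (.guard (.refl ?_ ?_)))) ?_ hJ <|
    .cons (.assign (x := rt) ?_) ?_ hJ' <|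
    .last (.choiceLeft (.guard (.refl ?_ ?_))) ?_ hJ', _, rfl, ?_, trivial⟩
  · simp [params, *]
  all_goals simp [NodeData.In, rrepUpdate, bindArgs, params, *]

end Rrep

end Routines

/-! ### Routines of a node as transitions of the network -/

section LeadsRoutines

variable {IP Data : Type} {ad : Fin 3 → IP} {R : Fin 3 → Set IP} {J : Fin 3 → Set (RT IP)}
  {K K' : Conf IP Data}

theorem Leads.mono {E E' : List (Event IP Data)} (h : Leads ad R J E K K') (hE : E' ⊆ E) :
    Leads ad R J E' K K' := by
  intro g hg
  obtain ⟨p, g', hp, hg', hE'⟩ := h g hg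
  exact ⟨p, g', hp, hg', fun ε hε => hE' ε (hE hε)⟩

theorem Leads.silent {E : List (Event IP Data)} (h : Leads ad R J E K K') :
    Leads ad R J [] K K' :=
  h.mono (by simp)

theorem Leads.proceed (i : Fin 3) {P P' : SState IP Data → Prop} {ms : List (Msg IP Data)}
    (h : Proceeds (J i) P P') (hK : K i = (P, ms)) (hK' : K' i = (P', ms))
    (hne : ∀ j, j ≠ i → K' j = K j) : Leads ad R J [] K K' :=
  .seqTau i (by rw [hK, hK']; exact h) (by rw [hK, hK']) hne

/-- Node `i` takes a message from its queue and proceeds to handle it. -/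
theorem Leads.handle (i : Fin 3) {P P' P'' : SState IP Data → Prop} {m : Msg IP Data}
    {ms : List (Msg IP Data)} (h : Receives (J i) m P P') (h' : Proceeds (J i) P' P'')
    (hK : K i = (P, m :: ms)) (hK' : K' i = (P'', ms)) (hne : ∀ j, j ≠ i → K' j = K j) :
    Leads ad R J [SyncEvent ad i] K K' := by
  -- The intermediate configuration only records that `P''` can still be reached, so the state after
  -- the reception need not be described.
  refine (Leads.receive (m := m) (K' := Function.update K i
    (fun s => ∃ s', SeqTau (J i) s s' ∧ P'' s', ms)) i ?_ (by simp [hK])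
    (by simp +contextual)).trans
    (.seqTau i ?_ (by simp [hK']) fun j hj => by simp [hj, hne j hj])
  · intro s hs
    rw [hK] at hs
    obtain ⟨s₁, h1, h2, s₂, h3, h4⟩ := h s hs
    obtain ⟨s₃, h5, h6⟩ := h' s₂ h4
    refine ⟨s₁, h1, h2, ?_⟩
    rw [Function.update_self]
    exact ⟨s₃, h3.trans h5, h6⟩
  · rw [hK', Function.update_self]
    exact fun _ h => h

theorem Proceeds.refl {J : Set (RT IP)} {P : SState IP Data → Prop} : Proceeds J P P :=
  fun s hs => ⟨s, .refl, hs⟩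

/-- Node `i` broadcasts `m`. -/
theorem Leads.bcast (i : Fin 3) {P P' : SState IP Data → Prop} {m : Msg IP Data}
    {ms : List (Msg IP Data)} (h : Acts (J i) (.bcast m) P P') (hK : K i = (P, ms))
    (hK' : K' i = (P', ms))
    (hne : ∀ j, j ≠ i →
      ad j ∈ R i ∧ K' j = ((K j).1, (K j).2 ++ [m]) ∨ ad j ∉ R i ∧ K' j = K j) :
    Leads ad R J [PerformEvent ad i (.bcast m)] K K' :=
  .cast i (by simp) .bcast (by rw [hK, hK']; exact h) (by rw [hK, hK']) hne

/-- Node `i` unicasts `m` to its neighbour `j`. -/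
theorem Leads.ucast (i j : Fin 3) {P P' : SState IP Data → Prop} {m : Msg IP Data}
    {ms : List (Msg IP Data)} (h : Acts (J i) (.ucast (ad j) m) P P') (hK : K i = (P, ms))
    (hK' : K' i = (P', ms)) (had : Function.Injective ad) (hR : ad j ∈ R i)
    (hj : K' j = ((K j).1, (K j).2 ++ [m])) (hne : ∀ k, k ≠ i → k ≠ j → K' k = K k) :
    Leads ad R J [] K K' := by
  refine (Leads.cast (D := {ad j}) (m := m) i (by simp) (.ucast hR) (by rw [hK, hK']; exact h)
    (by rw [hK, hK']) fun k hk => ?_).silent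
  by_cases hkj : k = j
  · subst hkj
    exact .inl ⟨rfl, hj⟩
  · exact .inr ⟨fun h => hkj (had h), hne k hk hkj⟩

/-- A data packet injected at its destination is delivered. -/
theorem Leads.selfDelivery (i : Fin 3) {n : NodeData IP Data} (d : Data) (hip : n.ip = ad i)
    (hJ : n.rt ∈ J i) (hK : K i = (MainAt n, [])) : Leads ad R J [SyncEvent ad i] K K := by
  refine (Leads.newpkt (K' := Function.update K i (MainAt n, [.newpkt d (ad i)])) i d (ad i)
    (by simp [hK]) (by simp +contextual)).trans <|
    .trans (E := [SyncEvent ad i]) (E' := []) (.handle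
      (K' := Function.update K i (DeliversAt n d, [])) (ms := []) i (receives_newpkt hJ d (ad i))
      (hip ▸ newpkt_deliver hJ) (by simp) (by simp) (by simp +contextual)) <|
    .deliver (d := d) i ?_ (by simp [hK]) (by simp +contextual)
  rw [hK, Function.update_self]
  exact DeliversAt.acts hJ

end LeadsRoutines

/-! ### Routing tables and stores -/

section Tables

variable {IP Data : Type}

theorem update_of_none {rt : RT IP} {dip : IP} {r : Entry IP} (h : rt dip = none)
    (hf : r.flag = .val) (hs : r.dsn = 0 ↔ r.dsk = .unk) (hu : r.dsk = .unk → r.hops = 1) :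
    ∃ rt', update rt dip r = some rt' ∧ rt' dip = some r ∧ ∀ x, x ≠ dip → rt' x = rt x := by
  refine ⟨_, if_pos ⟨hf, hs, hu⟩, ?_, ?_⟩ <;> simp +contextual [h]

theorem update_of_lt {rt : RT IP} {dip : IP} {r e : Entry IP} (h : rt dip = some e)
    (hf : r.flag = .val) (hs : r.dsn = 0 ↔ r.dsk = .unk) (hu : r.dsk = .unk → r.hops = 1)
    (hlt : e.dsn < r.dsn) :
    ∃ rt', update rt dip r = some rt' ∧ rt' dip = some (r.addpre e.pre) ∧
      ∀ x, x ≠ dip → rt' x = rt x := by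
  refine ⟨_, if_pos ⟨hf, hs, hu⟩, ?_, ?_⟩ <;> simp +contextual [h, hlt]

/-- A route with unknown number does not beat a valid one of at most one hop. The second branch then
overwrites the entry but retains the old sequence number, so only the status degrades to unknown. -/
theorem update_of_unk {rt : RT IP} {dip : IP} {e : Entry IP} (h : rt dip = some e)
    (hf : e.flag = .val) (hh : e.hops ≤ 1) (nhip : IP) (pre : Set IP) :
    ∃ rt', update rt dip ⟨0, .unk, .val, 1, nhip, pre⟩ = some rt' ∧
      rt' dip = some ⟨e.dsn, .unk, .val, 1, nhip, pre ∪ e.pre⟩ ∧ ∀ x, x ≠ dip → rt' x = rt x := by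
  refine ⟨_, if_pos ⟨rfl, by simp, by simp⟩, ?_, ?_⟩
  · simp [h, hf, Entry.addpre, hh]
  · simp +contextual

/-- Equal number, no fewer hops, and a valid old route lead to the last branch, which only adds
precursors, here none. The status of the old entry is not compared: an entry degraded to `unk` by
`update_of_unk` still blocks the reply. The number must be nonzero for the update with status `kno`
to be defined. -/
theorem update_of_not_better {rt : RT IP} {dip : IP} {e : Entry IP} (h : rt dip = some e)
    (hf : e.flag = .val) (h0 : e.dsn ≠ 0) {hops : ℕ} (hh : e.hops ≤ hops) (nhip : IP) :
    update rt dip ⟨e.dsn, .kno, .val, hops, nhip, ∅⟩ = some rt := by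
  refine (if_pos ⟨rfl, by simp [h0], by simp⟩).trans ?_
  congr 1
  funext x
  by_cases hx : x = dip
  · subst hx
    simp only [h, hf, Function.update_self, Entry.addpre, lt_self_iff_false, hh.not_gt, and_false,
      or_self, if_false, reduceCtorEq, Set.union_empty]
    rw [← hf]
  · simp [hx]

theorem nrreqid_empty (ip : IP) : nrreqid ∅ ip = some 1 := by
  simp [nrreqid]

end Tables

/-! ### The scenario in which the reply is lost -/

section Scenario

variable {IP Data : Type}

/-- The configuration in which all nodes are about to perform the basic routine with the given data,
and all message queues are empty. -/
def idleConf (n : Fin 3 → NodeData IP Data) : Conf IP Data := fun i => (MainAt (n i), [])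

def initData (ip : IP) : NodeData IP Data := ⟨ip, 1, fun _ => none, ∅, fun _ => none⟩

/-- No data packet can be sent, and no route request can be initiated. -/
def NodeData.Settled (n : NodeData IP Data) : Prop :=
  ∀ x, (x ∈ qD n.store → x ∉ vD n.rt) ∧ selFlag n.store x ≠ some .req

/-- Routing tables without an entry for `d` on the node `0`. -/
def noRoute (d : IP) : Fin 3 → Set (RT IP) := ![{rt | rt d = none}, Set.univ, Set.univ]

def lineAddr (s a d : IP) : Fin 3 → IP := ![s, a, d]

theorem lineAddr_injective {s a d : IP} (hsa : s ≠ a) (had : a ≠ d) (hsd : s ≠ d) :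
    Function.Injective (lineAddr s a d) := by
  intro i j
  fin_cases i <;> fin_cases j <;> simp [lineAddr, hsa, had, hsd, hsa.symm, had.symm, hsd.symm]

def lineRange (s a d : IP) : Fin 3 → Set IP := ![{a}, {s, d}, {a}]

/-- The node `1` ignores a route reply for `s` concerning `d`. -/
def DropEvent (s d : IP) : Event IP Data := fun e =>
  ∃ n : NodeData IP Data, update n.rt d ⟨2, .kno, .val, 1, d, ∅⟩ = some n.rt ∧
    CallAt .rrep n (RrepFields 0 d 2 s d) (e.1 1).1 ∧ MainAt n (e.2.2 1).1

/-- The two recorded events are the request of `s` and the drop at `a`. The packet injected at `d`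
for `a` has the sole purpose of making `d` issue a request, so that `a` already knows what the reply
of `d` will say. The rest of the scenario empties the queues and the store of `d`. -/
theorem lost_reply (x : Data) {s a d : IP} (hsa : s ≠ a) (had : a ≠ d) (hsd : s ≠ d) :
    ∃ n : Fin 3 → NodeData IP Data, (∀ i, (n i).ip = lineAddr s a d i) ∧
      (∀ i, (n i).rt ∈ noRoute d i) ∧ (∀ i, (n i).Settled) ∧
      Leads (lineAddr s a d) (lineRange s a d) (noRoute d)
        [PerformEvent (lineAddr s a d) 0 (.bcast (.rreq 0 1 d 0 .unk s 2 s)), DropEvent s d]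
        (idleConf fun i => initData (lineAddr s a d i)) (idleConf n) := by
  have inj := lineAddr_injective hsa had hsd
  let o : RT IP := fun _ => none
  let u : Store IP Data := fun _ => none
  let m₁ : Msg IP Data := .rreq 0 1 d 0 .unk s 2 s
  let m₁' : Msg IP Data := .rreq 1 1 d 0 .unk s 2 a
  let m₂ : Msg IP Data := .rreq 0 1 a 0 .unk d 2 d
  let r₁ : Msg IP Data := .rrep 0 a 1 d a
  let r₂ : Msg IP Data := .rrep 0 d 2 s d
  -- the routing tables of `s`
  obtain ⟨rtS, hS, hSa, hSx⟩ := update_of_none (rt := o) (dip := a) (r := ⟨0, .unk, .val, 1, a, ∅⟩)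
    rfl rfl (by simp) (by simp)
  have hSd : rtS d = none := hSx d had.symm
  -- the routing tables of `a`
  obtain ⟨rtA₁, hA₁, hA₁s, hA₁x⟩ := update_of_none (rt := o) (dip := s)
    (r := ⟨0, .unk, .val, 1, s, ∅⟩) rfl rfl (by simp) (by simp)
  obtain ⟨rtA₂, hA₂, hA₂s, hA₂x⟩ := update_of_lt (r := ⟨2, .kno, .val, 1, s, ∅⟩) hA₁s rfl (by simp)
    (by simp) (by simp)
  -- With no entry for `d`, node `a` has to forward the request of `s` rather than answer it.
  have hA₂d : rtA₂ d = none := (hA₂x d hsd.symm).trans (hA₁x d hsd.symm)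
  obtain ⟨rtA₃, hA₃, hA₃d, -⟩ := update_of_none (r := ⟨0, .unk, .val, 1, d, ∅⟩) hA₂d rfl (by simp)
    (by simp)
  obtain ⟨rtA₄, hA₄, hA₄d, -⟩ := update_of_lt (r := ⟨2, .kno, .val, 1, d, ∅⟩) hA₃d rfl (by simp)
    (by simp) (by simp)
  -- The reply comes from `d` itself, so the entry for the previous hop is renewed first: number 2
  -- survives, with unknown status.
  obtain ⟨rtA₅, hA₅, hA₅d, -⟩ := update_of_unk hA₄d rfl le_rfl d ∅
  -- The reply offers number 2 and one hop, exactly what the entry has: the table is unchanged.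
  have hA₆ := update_of_not_better hA₅d rfl (by simp [Entry.addpre]) (hops := 1) le_rfl d
  -- the routing tables of `d`
  obtain ⟨rtD₁, hD₁, hD₁a, hD₁x⟩ := update_of_none (rt := o) (dip := a)
    (r := ⟨0, .unk, .val, 1, a, ∅⟩) rfl rfl (by simp) (by simp)
  obtain ⟨rtD₂, hD₂, hD₂s, hD₂x⟩ := update_of_none (rt := rtD₁) (dip := s)
    (r := ⟨2, .kno, .val, 2, a, ∅⟩) (hD₁x s hsa) rfl (by simp) (by simp)
  have hD₂a := (hD₂x a hsa.symm).trans hD₁a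
  obtain ⟨rtD₃, hD₃, hD₃a, -⟩ := update_of_unk hD₂a rfl le_rfl a ∅
  obtain ⟨rtD₄, hD₄, hD₄a, -⟩ := update_of_lt (r := ⟨1, .kno, .val, 1, a, ∅⟩) hD₃a rfl (by simp)
    (by simp) (by simp)
  -- The entries for `a` have numbers 0 and 1, so the reply of `a` is not ignored by `d`.
  have hD₃₄ : rtD₃ ≠ rtD₄ := by
    intro h
    rw [← h, hD₃a] at hD₄a
    simp [Entry.addpre] at hD₄a
  -- the store of `d`
  have hdrop : drop a (unsetRRF (add x a u) a) = some fun _ => none := by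
    simp only [drop, unsetRRF, add, u, Function.update_self, Option.map_some, Function.update_idem]
    congr 1
    funext y
    by_cases hy : y = a <;> simp [hy]
  -- Successive data of the nodes. Unions such as `∅ ∪ {(s, 1)}` keep the shape produced by the
  -- routine lemmas, so that consecutive configurations agree by `rfl`.
  let nS₁ : NodeData IP Data := ⟨s, 1, o, ∅, add x d u⟩
  let nS₂ : NodeData IP Data := ⟨s, 2, o, ∅ ∪ {(s, 1)}, unsetRRF (add x d u) d⟩
  let nS₃ : NodeData IP Data := ⟨s, 2, rtS, ∅ ∪ {(s, 1)}, unsetRRF (add x d u) d⟩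
  let nA₁ : NodeData IP Data := ⟨a, 1, rtA₂, ∅ ∪ {(s, 1)}, u⟩
  let nA₂ : NodeData IP Data := ⟨a, 1, rtA₄, ∅ ∪ {(s, 1)} ∪ {(d, 1)}, u⟩
  let nA₃ : NodeData IP Data := ⟨a, 1, rtA₅, ∅ ∪ {(s, 1)} ∪ {(d, 1)}, u⟩
  let nD₁ : NodeData IP Data := ⟨d, 1, o, ∅, add x a u⟩
  let nD₂ : NodeData IP Data := ⟨d, 2, o, ∅ ∪ {(d, 1)}, unsetRRF (add x a u) a⟩
  let nD₃ : NodeData IP Data := ⟨d, 2, rtD₂, ∅ ∪ {(d, 1)} ∪ {(s, 1)}, unsetRRF (add x a u) a⟩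
  let nD₄ : NodeData IP Data := ⟨d, 2, rtD₄, ∅ ∪ {(d, 1)} ∪ {(s, 1)}, unsetRRF (add x a u) a⟩
  let nD₅ : NodeData IP Data := ⟨d, 2, rtD₄, ∅ ∪ {(d, 1)} ∪ {(s, 1)}, fun _ => none⟩
  let nA₀ : NodeData IP Data := initData a
  let nD₀ : NodeData IP Data := initData d
  have oS : o ∈ noRoute d 0 := rfl
  have JA : ∀ rt, rt ∈ noRoute d 1 := fun _ => trivial
  have JD : ∀ rt, rt ∈ noRoute d 2 := fun _ => trivial
  refine ⟨![nS₃, nA₃, nD₅], ?_, ?_, ?_, ?_⟩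
  · intro i
    fin_cases i <;> rfl
  · intro i
    fin_cases i
    exacts [hSd, trivial, trivial]
  · intro i y
    fin_cases i
    -- The packet for `d` is still queued at `s`, but there is no route and the flag has been
    -- cleared.
    · by_cases hy : y = d
      · subst hy
        simp [nS₃, vD, hSd, selFlag, unsetRRF, add, u]
      · simp [nS₃, qD, selFlag, unsetRRF, add, u, hy]
    · simp [nA₃, qD, selFlag, u]
    · simp [nD₅, qD, selFlag]
  -- `s` initiates a route request for `d`
  have h₁ : Leads (lineAddr s a d) (lineRange s a d) (noRoute d) []
      (idleConf fun i => initData (lineAddr s a d i))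
      ![(MainAt (initData s), [.newpkt x d]), (MainAt nA₀, []), (MainAt nD₀, [])] :=
    .newpkt 0 x d rfl (by intro j hj; fin_cases j <;> first | rfl | exact absurd rfl hj)
  have h₂ : Leads (lineAddr s a d) (lineRange s a d) (noRoute d) []
      ![(MainAt (initData s), [.newpkt x d]), (MainAt nA₀, []), (MainAt nD₀, [])]
      ![(MainAt nS₁, []), (MainAt nA₀, []), (MainAt nD₀, [])] :=
    (Leads.handle 0 (receives_newpkt oS x d) (newpkt_store oS hsd.symm) rfl rfl
      (by intro j hj; fin_cases j <;> first | rfl | exact absurd rfl hj)).silent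
  have h₃ : Leads (lineAddr s a d) (lineRange s a d) (noRoute d) []
      ![(MainAt nS₁, []), (MainAt nA₀, []), (MainAt nD₀, [])]
      ![(BcastAt nS₂ m₁, []), (MainAt nA₀, []), (MainAt nD₀, [])] :=
    .proceed 0 (initiate_rreq (dip := d) (id := 1) oS (by simp [nS₁, selFlag, add, u])
      (by simp [nS₁, vD, o]) (nrreqid_empty s)) rfl rfl
      (by intro j hj; fin_cases j <;> first | rfl | exact absurd rfl hj)
  have h₄ : Leads (lineAddr s a d) (lineRange s a d) (noRoute d)
      [PerformEvent (lineAddr s a d) 0 (.bcast m₁)]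
      ![(BcastAt nS₂ m₁, []), (MainAt nA₀, []), (MainAt nD₀, [])]
      ![(MainAt nS₂, []), (MainAt nA₀, [m₁]), (MainAt nD₀, [])] :=
    .bcast 0 (BcastAt.acts oS) rfl rfl (by
      intro j hj
      fin_cases j
      exacts [absurd rfl hj, .inl ⟨rfl, rfl⟩, .inr ⟨had.symm, rfl⟩])
  -- `d` is asked to send a packet to `a`
  have h₅ : Leads (lineAddr s a d) (lineRange s a d) (noRoute d) []
      ![(MainAt nS₂, []), (MainAt nA₀, [m₁]), (MainAt nD₀, [])]
      ![(MainAt nS₂, []), (MainAt nA₀, [m₁]), (MainAt nD₀, [.newpkt x a])] :=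
    .newpkt 2 x a rfl (by intro j hj; fin_cases j <;> first | rfl | exact absurd rfl hj)
  have h₆ : Leads (lineAddr s a d) (lineRange s a d) (noRoute d) []
      ![(MainAt nS₂, []), (MainAt nA₀, [m₁]), (MainAt nD₀, [.newpkt x a])]
      ![(MainAt nS₂, []), (MainAt nA₀, [m₁]), (MainAt nD₁, [])] :=
    (Leads.handle 2 (receives_newpkt (JD _) x a) (newpkt_store (JD _) had) rfl rfl
      (by intro j hj; fin_cases j <;> first | rfl | exact absurd rfl hj)).silent
  -- `a` forwards the request of `s`
  have h₇ : Leads (lineAddr s a d) (lineRange s a d) (noRoute d) []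
      ![(MainAt nS₂, []), (MainAt nA₀, [m₁]), (MainAt nD₁, [])]
      ![(MainAt nS₂, []), (BcastAt nA₁ m₁', []), (MainAt nD₁, [])] := by
    refine (Leads.handle 1 (receives_rreq (JA _) (JA _) hA₁)
      (rreq_forward (JA _) (JA _) ?_ hA₂ had.symm ?_) rfl ?_
      (by intro j hj; fin_cases j <;> first | rfl | exact absurd rfl hj)).silent
    · simp [nA₀, initData]
    · simp [vD, hA₂d]
    · simp [nA₁, nA₀, initData, m₁', sqn, hA₂d, u]
  have h₈ : Leads (lineAddr s a d) (lineRange s a d) (noRoute d) []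
      ![(MainAt nS₂, []), (BcastAt nA₁ m₁', []), (MainAt nD₁, [])]
      ![(MainAt nS₂, [m₁']), (MainAt nA₁, []), (MainAt nD₁, [m₁'])] :=
    (Leads.bcast 1 (BcastAt.acts (JA _)) rfl rfl (by
      intro j hj
      fin_cases j
      exacts [.inl ⟨.inl rfl, rfl⟩, absurd rfl hj, .inl ⟨.inr rfl, rfl⟩])).silent
  -- `d` initiates a route request for `a`
  have h₉ : Leads (lineAddr s a d) (lineRange s a d) (noRoute d) []
      ![(MainAt nS₂, [m₁']), (MainAt nA₁, []), (MainAt nD₁, [m₁'])]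
      ![(MainAt nS₂, [m₁']), (MainAt nA₁, []), (BcastAt nD₂ m₂, [m₁'])] :=
    -- This is possible because `m₁'` still waits in the queue of `d`; handling it would provide a
    -- valid route to `a`.
    .proceed 2 (initiate_rreq (dip := a) (id := 1) (JD _) (by simp [nD₁, selFlag, add, u])
      (by simp [nD₁, vD, o]) (nrreqid_empty d)) rfl rfl
      (by intro j hj; fin_cases j <;> first | rfl | exact absurd rfl hj)
  have h₁₀ : Leads (lineAddr s a d) (lineRange s a d) (noRoute d) []
      ![(MainAt nS₂, [m₁']), (MainAt nA₁, []), (BcastAt nD₂ m₂, [m₁'])]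
      ![(MainAt nS₂, [m₁']), (MainAt nA₁, [m₂]), (MainAt nD₂, [m₁'])] :=
    (Leads.bcast 2 (BcastAt.acts (JD _)) rfl rfl (by
      intro j hj
      fin_cases j
      exacts [.inr ⟨hsa, rfl⟩, .inl ⟨rfl, rfl⟩, absurd rfl hj])).silent
  -- `a` answers the request of `d`
  have h₁₁ : Leads (lineAddr s a d) (lineRange s a d) (noRoute d) []
      ![(MainAt nS₂, [m₁']), (MainAt nA₁, [m₂]), (MainAt nD₂, [m₁'])]
      ![(MainAt nS₂, [m₁']), (UcastAt nA₂ d r₁, []), (MainAt nD₂, [m₁'])] := by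
    refine (Leads.handle 1 (receives_rreq (JA _) (JA _) hA₃)
      (rreq_destination (n := { nA₁ with rt := rtA₃ }) (dest := d) (JA _) (JA _) ?_ hA₄ ?_) rfl rfl
      (by intro j hj; fin_cases j <;> first | rfl | exact absurd rfl hj)).silent
    · simp [nA₁, hsd.symm]
    · simp [nhop, hA₄d, Entry.addpre]
  have h₁₂ : Leads (lineAddr s a d) (lineRange s a d) (noRoute d) []
      ![(MainAt nS₂, [m₁']), (UcastAt nA₂ d r₁, []), (MainAt nD₂, [m₁'])]
      ![(MainAt nS₂, [m₁']), (MainAt nA₂, []), (MainAt nD₂, [m₁', r₁])] :=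
    .ucast 1 2 (UcastAt.acts (JA _)) rfl rfl inj (.inr rfl) rfl (by
      intro j hj hj'
      fin_cases j <;> first | rfl | exact absurd rfl hj | exact absurd rfl hj')
  -- `d` answers the request of `s`
  have h₁₃ : Leads (lineAddr s a d) (lineRange s a d) (noRoute d) []
      ![(MainAt nS₂, [m₁']), (MainAt nA₂, []), (MainAt nD₂, [m₁', r₁])]
      ![(MainAt nS₂, [m₁']), (MainAt nA₂, []), (UcastAt nD₃ a r₂, [r₁])] := by
    -- The own number of `d` is already 2 and the request asks for 0, so the reply repeats the
    -- number that `a` has learned.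
    refine (Leads.handle 2 (receives_rreq (JD _) (JD _) hD₁)
      (rreq_destination (n := { nD₂ with rt := rtD₁ }) (dest := a) (JD _) (JD _) ?_ hD₂ ?_) rfl rfl
      (by intro j hj; fin_cases j <;> first | rfl | exact absurd rfl hj)).silent
    · simp [nD₂, hsd]
    · simp [nhop, hD₂s]
  have h₁₄ : Leads (lineAddr s a d) (lineRange s a d) (noRoute d) []
      ![(MainAt nS₂, [m₁']), (MainAt nA₂, []), (UcastAt nD₃ a r₂, [r₁])]
      ![(MainAt nS₂, [m₁']), (MainAt nA₂, [r₂]), (MainAt nD₃, [r₁])] :=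
    .ucast 2 1 (UcastAt.acts (JD _)) rfl rfl inj rfl rfl (by
      intro j hj hj'
      fin_cases j <;> first | rfl | exact absurd rfl hj | exact absurd rfl hj')
  -- `a` drops the reply of `d`
  have h₁₅ : Leads (lineAddr s a d) (lineRange s a d) (noRoute d) []
      ![(MainAt nS₂, [m₁']), (MainAt nA₂, [r₂]), (MainAt nD₃, [r₁])]
      ![(MainAt nS₂, [m₁']), (CallAt .rrep nA₃ (RrepFields 0 d 2 s d), []), (MainAt nD₃, [r₁])] :=
    (Leads.handle 1 (receives_rrep (JA _) (JA _) hA₅) .refl rfl rfl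
      (by intro j hj; fin_cases j <;> first | rfl | exact absurd rfl hj)).silent
  have h₁₆ : Leads (lineAddr s a d) (lineRange s a d) (noRoute d) [DropEvent s d]
      ![(MainAt nS₂, [m₁']), (CallAt .rrep nA₃ (RrepFields 0 d 2 s d), []), (MainAt nD₃, [r₁])]
      ![(MainAt nS₂, [m₁']), (MainAt nA₃, []), (MainAt nD₃, [r₁])] := by
    have h : Acts (noRoute d 1) .tau (CallAt .rrep nA₃ (RrepFields 0 d 2 s d)) (MainAt nA₃) :=
      rrep_ignore (JA _) hA₆
    have h' := Leads.tau (ad := lineAddr s a d) (R := lineRange s a d) (J := noRoute d)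
      (K := ![(MainAt nS₂, [m₁']), (CallAt .rrep nA₃ (RrepFields 0 d 2 s d), []), (MainAt nD₃,
        [r₁])])
      (K' := ![(MainAt nS₂, [m₁']), (MainAt nA₃, []), (MainAt nD₃, [r₁])]) 1 h rfl
      (by intro j hj; fin_cases j <;> first | rfl | exact absurd rfl hj)
    -- `h'` records the states of `a` on both sides of the step; with `hA₆` they form the drop
    -- event.
    intro g hg
    obtain ⟨p, g', hp, hg', hE⟩ := h' g hg
    obtain ⟨e, he, h⟩ := hE _ (List.mem_singleton_self _)
    refine ⟨p, g', hp, hg', fun ε hε => ⟨e, he, ?_⟩⟩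
    rw [List.mem_singleton.1 hε]
    exact ⟨nA₃, hA₆, h⟩
  -- `d` sends its data packet to `a`
  have h₁₇ : Leads (lineAddr s a d) (lineRange s a d) (noRoute d) []
      ![(MainAt nS₂, [m₁']), (MainAt nA₃, []), (MainAt nD₃, [r₁])]
      ![(MainAt nS₂, [m₁']), (MainAt nA₃, []), (MainAt nD₄, [])] :=
    (Leads.handle 2 (receives_rrep (JD _) (JD _) hD₃)
      (rrep_originator (n := { nD₃ with rt := rtD₃ }) (JD _) (JD _) hD₄ hD₃₄) rfl rfl
      (by intro j hj; fin_cases j <;> first | rfl | exact absurd rfl hj)).silent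
  have h₁₈ : Leads (lineAddr s a d) (lineRange s a d) (noRoute d) []
      ![(MainAt nS₂, [m₁']), (MainAt nA₃, []), (MainAt nD₄, [])]
      ![(MainAt nS₂, [m₁']), (MainAt nA₃, []), (SendsPktAt nD₄ a x a fun _ => none, [])] :=
    .proceed 2 (initiate_pkt (JD _) ⟨_, hD₄a, rfl⟩ (by simp [nD₄, nhop, hD₄a, Entry.addpre])
      (by simp [nD₄, selQueue, unsetRRF, add, u]) hdrop) rfl rfl
      (by intro j hj; fin_cases j <;> first | rfl | exact absurd rfl hj)
  have h₁₉ : Leads (lineAddr s a d) (lineRange s a d) (noRoute d) []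
      ![(MainAt nS₂, [m₁']), (MainAt nA₃, []), (SendsPktAt nD₄ a x a fun _ => none, [])]
      ![(MainAt nS₂, [m₁']), (MainAt nA₃, [.pkt x a d]), (DropsPktAt nD₄ fun _ => none, [])] :=
    .ucast 2 1 (SendsPktAt.acts (JD _)) rfl rfl inj rfl rfl (by
      intro j hj hj'
      fin_cases j <;> first | rfl | exact absurd rfl hj | exact absurd rfl hj')
  have h₂₀ : Leads (lineAddr s a d) (lineRange s a d) (noRoute d) []
      ![(MainAt nS₂, [m₁']), (MainAt nA₃, [.pkt x a d]), (DropsPktAt nD₄ fun _ => none, [])]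
      ![(MainAt nS₂, [m₁']), (MainAt nA₃, [.pkt x a d]), (MainAt nD₅, [])] :=
    .proceed 2 (dropsPkt (JD _)) rfl rfl
      (by intro j hj; fin_cases j <;> first | rfl | exact absurd rfl hj)
  have h₂₁ : Leads (lineAddr s a d) (lineRange s a d) (noRoute d) []
      ![(MainAt nS₂, [m₁']), (MainAt nA₃, [.pkt x a d]), (MainAt nD₅, [])]
      ![(MainAt nS₂, [m₁']), (DeliversAt nA₃ x, []), (MainAt nD₅, [])] :=
    (Leads.handle 1 (receives_pkt (JA _) x a d) (pkt_deliver (n := nA₃) (JA _)) rfl rfl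
      (by intro j hj; fin_cases j <;> first | rfl | exact absurd rfl hj)).silent
  have h₂₂ : Leads (lineAddr s a d) (lineRange s a d) (noRoute d) []
      ![(MainAt nS₂, [m₁']), (DeliversAt nA₃ x, []), (MainAt nD₅, [])]
      ![(MainAt nS₂, [m₁']), (MainAt nA₃, []), (MainAt nD₅, [])] :=
    .deliver 1 (DeliversAt.acts (JA _)) rfl
      (by intro j hj; fin_cases j <;> first | rfl | exact absurd rfl hj)
  -- `s` ignores its own request, forwarded by `a`
  have h₂₃ : Leads (lineAddr s a d) (lineRange s a d) (noRoute d) []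
      ![(MainAt nS₂, [m₁']), (MainAt nA₃, []), (MainAt nD₅, [])]
      (idleConf ![nS₃, nA₃, nD₅]) :=
    (Leads.handle 0 (receives_rreq oS hSd hS) (rreq_seen (n := nS₃) hSd (by simp [nS₃])) rfl rfl
      (by intro j hj; fin_cases j <;> first | rfl | exact absurd rfl hj)).silent
  exact h₁.trans <| h₂.trans <| h₃.trans <| h₄.trans <| h₅.trans <| h₆.trans <| h₇.trans <|
    h₈.trans <| h₉.trans <| h₁₀.trans <| h₁₁.trans <| h₁₂.trans <| h₁₃.trans <| h₁₄.trans <|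
    h₁₅.trans <| h₁₆.trans <| h₁₇.trans <| h₁₈.trans <| h₁₉.trans <| h₂₀.trans <| h₂₁.trans <|
    h₂₂.trans h₂₃

end Scenario

/-! ### Observations along a run and fairness on infinite paths -/

section Observations

variable {IP Data : Type}

theorem LineState.vals_net {ad : Fin 3 → IP} {R : Fin 3 → Set IP} {g : LineState IP Data} {ip : IP}
    {ξ ζ : Val IP Data} (h : (g.net ad R).Vals ip ξ ζ) :
    ∃ i, ip = ad i ∧ ξ = (g i).1.1 ∧ ζ = (g i).2.1 := by
  obtain ⟨p, q, R', h⟩ := h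
  simp only [net, proc, PNet.HasNode, PP.par.injEq, PP.seq.injEq] at h
  rcases h with ⟨h, ⟨h1, h2⟩, -⟩ | ⟨h, ⟨h1, h2⟩, -⟩ | ⟨h, ⟨h1, h2⟩, -⟩
  · exact ⟨0, h.symm, by rw [h1], by rw [h2]⟩
  · exact ⟨1, h.symm, by rw [h1], by rw [h2]⟩
  · exact ⟨2, h.symm, by rw [h1], by rw [h2]⟩

theorem LineState.hasNode_net (ad : Fin 3 → IP) (R : Fin 3 → Set IP) (g : LineState IP Data)
    (i : Fin 3) : (g.net ad R).inner.HasNode (ad i) (g.proc i) (R i) := by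
  fin_cases i
  exacts [.inl ⟨rfl, rfl, rfl⟩, .inr (.inl ⟨rfl, rfl, rfl⟩), .inr (.inr ⟨rfl, rfl, rfl⟩)]

theorem Path.obs_even (π : Path (Net IP Data) (NLabel IP Data)) (k : ℕ) :
    π.obs (2 * k) = ⟨π.st k, none⟩ := by
  simp [Path.obs]

theorem Path.obs_odd (π : Path (Net IP Data) (NLabel IP Data)) (k : ℕ) :
    π.obs (2 * k + 1) = ⟨π.st (k + 1), π.act k⟩ := by
  have h : (2 * k + 1) / 2 = k := by omega
  simp [Path.obs, h]

/-- On infinite paths, a fairness property holds if its premise fails infinitely often or its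
conclusion holds infinitely often. -/
theorem Path.satisfies_fairness {π : Path (Net IP Data) (NLabel IP Data)} (hπ : π.len = ⊤)
    {φ ψ : LTL (Obs IP Data)}
    (h : ∀ n : ℕ, ∃ k, n ≤ k ∧ (¬ φ.Sat (2 * π.len) π.obs k ∨ ψ.Sat (2 * π.len) π.obs k)) :
    π.Satisfies (.G (.imp (.G φ) (.F ψ))) := by
  intro n _ _ hφ
  have hL : ∀ j : ℕ, (j : ℕ∞) ≤ 2 * π.len := by simp [hπ]
  obtain ⟨k, hk, h | h⟩ := h n
  · exact absurd (hφ k hk (hL k)) h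
  · exact ⟨k, hk, hL k, h⟩

end Observations

/-! ### The initial state and the cycle that prolongs the run forever -/

section Run

variable {IP Data : Type}

/-- The initial state of a network of three nodes. -/
def initLineState (ad : Fin 3 → IP) : LineState IP Data := fun i =>
  ((initVal (ad i), .callVars .aodv), (initQueueVal, .callVars .qmsg))

theorem idleConf_initLineState (ad : Fin 3 → IP) :
    (idleConf fun i => initData (ad i) : Conf IP Data).At (initLineState ad) := fun _ =>
  ⟨⟨_, rfl, ⟨rfl, rfl, rfl, rfl, rfl⟩, trivial⟩, _, _, rfl, rfl⟩

/-- From an idle configuration, data packets can be injected at their destinations forever. -/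
theorem exists_cycle {ad : Fin 3 → IP} {R : Fin 3 → Set IP} {J : Fin 3 → Set (RT IP)}
    {n : Fin 3 → NodeData IP Data} (x : Data) (hip : ∀ i, (n i).ip = ad i)
    (hJ : ∀ i, (n i).rt ∈ J i) (g : LineState IP Data) (hg : (idleConf n).At g) :
    ∃ p g', p ≠ [] ∧ Trace (LineStepKeeps ad R J) g p g' ∧ (idleConf n).At g' ∧
      ∀ i : Option (Fin 3), ∃ e ∈ p,
        i.elim (fun e => (idleConf n).At e.1) (fun i => SyncEvent ad i) e := by
  have h : ∀ i, Leads ad R J [SyncEvent ad i] (idleConf n) (idleConf n) := fun i =>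
    .selfDelivery i x (hip i) (hJ i) rfl
  obtain ⟨p, g', hp, hg', hE⟩ := (h 0).trans ((h 1).trans (h 2)) g hg
  refine ⟨p, g', ?_, hp, hg', ?_⟩
  · rintro rfl
    obtain ⟨e, he, -⟩ := hE (SyncEvent ad 0) (.head _)
    simp at he
  · rintro (_ | i)
    -- The index `none` stands for the recurrence of the idle configuration: the first transition of
    -- the cycle starts in it.
    · cases hp with
      | nil =>
        obtain ⟨e, he, -⟩ := hE (SyncEvent ad 0) (.head _)
        simp at he
      | cons => exact ⟨_, .head _, hg⟩
    · refine hE (SyncEvent ad i) ?_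
      fin_cases i
      exacts [.head _, .tail _ (.head _), .tail _ (.tail _ (.head _))]

end Run

end AODV

/-- AODV does not satisfy route discovery. For any three distinct addresses `s`, `a`, `d` there is a
complete, fair run in the linear three-node topology `s — a — d`, in which the topology never
changes and the intermediate node `a` drops a route reply destined for `s`, that violates the route
discovery property for the originator `s` and the destination `d`. -/
theorem mainTheorem5 {IP Data : Type} [Nonempty Data] (s a d : IP)
    (hsa : s ≠ a) (had : a ≠ d) (hsd : s ≠ d) :
    ¬ AODV.SatisfiesRouteDiscovery IP Data ∧
    ∃ π : AODV.Path (AODV.Net IP Data) (AODV.NLabel IP Data),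
      AODV.IsRun π ∧ π.st 0 = AODV.lineNet s a d ∧
      (∀ (k : ℕ) (x y : IP) (t : List (IP × AODV.Act IP Data)), (k : ℕ∞) < π.len →
        π.act k ≠ some (.connect x y, t) ∧ π.act k ≠ some (.disconnect x y, t)) ∧
      (∃ k : ℕ, (k : ℕ∞) < π.len ∧ AODV.DropsRrep a s d (π.st k) (π.st (k + 1))) ∧
      ¬ π.Satisfies (AODV.routeDiscovery s d) := by
  open AODV in
  suffices h : ∃ π : Path (Net IP Data) (NLabel IP Data),
      IsRun π ∧ π.st 0 = lineNet s a d ∧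
      (∀ (k : ℕ) (x y : IP) (t : List (IP × Act IP Data)), (k : ℕ∞) < π.len →
        π.act k ≠ some (.connect x y, t) ∧ π.act k ≠ some (.disconnect x y, t)) ∧
      (∃ k : ℕ, (k : ℕ∞) < π.len ∧ DropsRrep a s d (π.st k) (π.st (k + 1))) ∧
      ¬ π.Satisfies (routeDiscovery s d) by
    refine ⟨fun hrd => ?_, h⟩
    obtain ⟨π, hrun, -, -, -, hπ⟩ := h
    exact hπ (hrd s d π hrun)
  obtain ⟨x⟩ := ‹Nonempty Data›
  obtain ⟨n, hip, hJ, hset, hlead⟩ := lost_reply x hsa had hsd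
  obtain ⟨p, g, hp, hg, hE⟩ := hlead _ (idleConf_initLineState _)
  -- `hpre` locates the two events of the scenario in the infinite run; `hinf` provides the
  -- recurring idle states and queue actions.
  obtain ⟨st, mv, h0, hstep, hpre, hinf⟩ := hp.exists_infinite (exists_cycle x hip hJ) hg
  have inj := lineAddr_injective hsa had hsd
  have hkeep : ∀ k i, Keeps (noRoute d i) (st k i).1.1 := by
    intro k
    induction k with
    | zero =>
      intro i
      rw [h0]
      refine keeps_of_eq_some rfl ?_
      fin_cases i
      exacts [rfl, trivial, trivial]
    | succ k ih => exact (hstep k).2 ih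
  let π : Path (Net IP Data) (NLabel IP Data) :=
    ⟨⊤, fun k => (st k).net (lineAddr s a d) (lineRange s a d), fun k => some (mv k).lab⟩
  have hL : ∀ j : ℕ, (j : ℕ∞) ≤ 2 * π.len := by simp [π]
  have hlab : ∀ k, _ := fun k => (hstep k).1.2.2.1
  have hidle : ∀ N : ℕ, ∃ k, N ≤ k ∧ (idleConf n).At (st k) := hinf none
  -- In idle states the table and the store of each node are fixed, and these are all that (F₁) and
  -- (F₂) inspect.
  have hdata : ∀ {k : ℕ}, (idleConf n).At (st k) → ∀ {ip : IP} {ξ ζ : Val IP Data},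
      (π.st k).Vals ip ξ ζ → ∃ i, ip = lineAddr s a d i ∧ ξ .rt = some (n i).rt ∧
        ξ .store = some (n i).store := by
    intro k hk ip ξ ζ h
    obtain ⟨i, h1, rfl, -⟩ := LineState.vals_net h
    obtain ⟨ξ, h2, h3, -⟩ := (hk i).1
    refine ⟨i, h1, ?_, ?_⟩ <;> rw [h2]
    exacts [h3.2.2.1, h3.2.2.2.2]
  refine ⟨π, ⟨⟨?_, ?_⟩, netComplete_of_lineStep (fun k => (hstep k).1) ?_, ?_, ?_, ?_⟩, ?_, ?_, ?_,
    ?_⟩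
  · simp [π, LineState.net, PNet.addrs, lineAddr, hsa, had, hsd]
  · intro ip P R h
    simp only [π, h0, LineState.net, LineState.proc, PNet.HasNode] at h
    rcases h with ⟨rfl, rfl, -⟩ | ⟨rfl, rfl, -⟩ | ⟨rfl, rfl, -⟩ <;> rfl
  · intro i N
    obtain ⟨k, hk, h1, h2, -⟩ := hinf (some i) N
    exact ⟨k, hk, h1, h2⟩
  -- (F₁): in an idle state no destination has both queued packets and a valid route.
  · refine fun ip dip => Path.satisfies_fairness rfl fun N => ?_
    obtain ⟨k, hk, hT⟩ := hidle N
    refine ⟨2 * k, by omega, .inl ?_⟩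
    rintro ⟨⟨ξ, ζ, store, h1, h2, h3⟩, ξ', ζ', rt, h4, h5, h6⟩
    rw [Path.obs_even] at h1 h4
    obtain ⟨i, hi, -, hs⟩ := hdata hT h1
    obtain ⟨j, hj, hr, -⟩ := hdata hT h4
    -- The two atoms provide separate valuations; distinct addresses force them to belong to the
    -- same node.
    obtain rfl := inj (hi.symm.trans hj)
    rw [hs] at h2
    rw [hr] at h5
    obtain rfl := Option.some.inj h2
    obtain rfl := Option.some.inj h5
    exact (hset i dip).1 h3 h6
  -- (F₂): in an idle state no request-required flag is set.
  · refine fun ip dip => Path.satisfies_fairness rfl fun N => ?_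
    obtain ⟨k, hk, hT⟩ := hidle N
    refine ⟨2 * k, by omega, .inl ?_⟩
    rintro ⟨-, ξ, ζ, store, h1, h2, h3⟩
    rw [Path.obs_even] at h1
    obtain ⟨i, hi, -, hs⟩ := hdata hT h1
    rw [hs] at h2
    obtain rfl := Option.some.inj h2
    exact (hset i dip).2 h3
  -- (F₃): the three queues send infinitely often, and for any other address the premise fails for
  -- lack of a node.
  · refine fun ip => Path.satisfies_fairness rfl fun N => ?_
    by_cases hip : ∃ i, ip = lineAddr s a d i
    · obtain ⟨i, rfl⟩ := hip
      obtain ⟨k, hk, -, -, m, hm⟩ := hinf (some i) N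
      refine ⟨2 * k + 1, by omega, .inr ⟨(mv k).lab.1, (mv k).lab.2, _, ?_, hm, m, rfl⟩⟩
      rw [Path.obs_odd]
    · refine ⟨2 * N, by omega, .inl ?_⟩
      rintro ⟨ξ, ζ, msgs, h1, -⟩
      rw [Path.obs_even] at h1
      obtain ⟨i, hi, -⟩ := LineState.vals_net h1
      exact hip ⟨i, hi⟩
  · simp only [π, h0]
    rfl
  · intro k y z t _
    obtain ⟨h1, h2⟩ := hlab k y z t
    exact ⟨fun h => h1 (Option.some.inj h), fun h => h2 (Option.some.inj h)⟩
  · obtain ⟨e, he, nA, hu, h1, h2⟩ := hE _ (.tail _ (.head _))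
    obtain ⟨k, rfl⟩ := hpre e he
    obtain ⟨ξ, h3, hξ, f1, f2, f3, f4, f5⟩ := h1
    obtain ⟨ξ', h4, -⟩ := h2
    refine ⟨k, ENat.natCast_lt_top k, hsa, ξ, ξ', (st k 1).2.1, (st (k + 1) 1).2.1, (st k 1).2.2,
      (st (k + 1) 1).2.2, lineRange s a d 1,
      lineRange s a d 1, ?_, ?_, f4, f2, by simp [hξ.2.2.1], ?_⟩
    · rw [← h3]
      exact (st k).hasNode_net _ _ 1
    · rw [← h4]
      exact (st (k + 1)).hasNode_net _ _ 1
    · simp [rrepUpdate, hξ.2.2.1, f1, f2, f3, f5, hu]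
  · intro h
    obtain ⟨e, he, hb⟩ := hE _ (.head _)
    obtain ⟨k, rfl⟩ := hpre e he
    have hn := LineState.hasNode_net (lineAddr s a d) (lineRange s a d) (st (k + 1))
    have hconn : s ∈ (π.st (k + 1)).inner.addrs ∧
        Relation.ReflTransGen (π.st (k + 1)).InRange s d :=
      ⟨.head _, .tail (.single (b := a) ⟨.tail _ (.head _), _, _, hn 0, rfl⟩)
        ⟨.tail _ (.tail _ (.head _)), _, _, hn 1, .inr rfl⟩⟩
    -- The request is observed halfway the transition, where the state predicates refer to its
    -- target; hence connectedness was shown for `st (k + 1)`.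
    obtain ⟨j, -, -, hj | hj⟩ := h (2 * k + 1) (by omega) (hL _) (by
      rw [LTL.Sat, connected, issuesRreq, performs, LTL.Sat, LTL.Sat, Path.obs_odd]
      exact ⟨hconn, (mv k).lab.1, (mv k).lab.2, _, rfl, hb, 0, 1, 0, .unk, 2, rfl⟩)
    · obtain ⟨ξ, ζ, rt, h1, h2, e, h3, -⟩ := hj
      have h4 : ∃ k, (π.obs j).net = π.st k := by
        rcases Nat.even_or_odd' j with ⟨m, rfl | rfl⟩
        · exact ⟨m, by rw [Path.obs_even]⟩
        · exact ⟨m + 1, by rw [Path.obs_odd]⟩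
      obtain ⟨m, h4⟩ := h4
      rw [h4] at h1
      obtain ⟨i, hi, rfl, -⟩ := LineState.vals_net h1
      obtain rfl : 0 = i := inj hi
      -- The address `s` belongs to node 0 only, whose tables never have an entry for `d`.
      have h5 : rt d = none := hkeep m 0 rt h2
      rw [h5] at h3
      cases h3
    · obtain ⟨y, z, t, h1⟩ := hj
      rcases Nat.even_or_odd' j with ⟨m, rfl | rfl⟩
      · rw [Path.obs_even] at h1
        cases h1
      · rw [Path.obs_odd] at h1
        exact (hlab m y z t).2 (Option.some.inj h1)
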